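/- Let $d\ge 0$ and let $\lambda$ be Lebesgue measure on $\mathbb{R}^d$. Let $U,V:\mathbb{R}^d\to\mathbb{R}$ be twice differentiable functions such that $\mu(dx):=e^{-U(x)}\lambda(dx)$ and $\eta(dx):=e^{-V(x)}\lambda(dx)$ are probability measures. Let $\alpha\in\mathbb{R}^d$, let $\beta,\tau\in\mathbb{R}^{d\times d}$ with $\beta$ invertible and $\tau$ (symmetric) positive definite, let $g_\tau$ be the density of the centered Gaussian distribution with covariance matrix $\tau$, and set $$W(x,y):=-\log g_\tau\big(y-(\alpha+\beta x)\big),\quad W^\flat(y,x):=W(x,y),\quad K_W(x,dy):=e^{-W(x,y)}\lambda(dy),\quad \chi:=\tau^{-1}\beta .$$ Write $K_W(f)(x):=\int K_W(x,dy)f(y)$, and similarly for $K_{W^\flat}$. Let $P:=\mu(dx)K_W(x,dy)$ be the reference distribution and let $\mathcal{H}(\cdot\,|\,\cdot)$ denote relative entropy. *Schrödinger bridge.* Let $P_{\mu,\eta}$ be a minimizer of $\mathcal{H}(Q\,|\,P)$ over the probability measures $Q$ on $\mathbb{R}^d\times\mathbb{R}^d$ with first marginal $\mu$ and second marginal $\eta$,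 the minimum being finite, and let $\mathcal{L}^\flat_{\eta,\mu}$ be a Markov transition with $P_{\mu,\eta}(d(x,y))=\eta(dy)\,\mathcal{L}^\flat_{\eta,\mu}(y,dx)$. Let $(\mathbb{U},\mathbb{V})$ be a pair of real-valued measurable functions solving the Schrödinger system, for all $x,y\in\mathbb{R}^d$ and with finite integrals, $$\mathbb{U}=U+\log K_W(e^{-\mathbb{V}}),\qquad \mathbb{V}=V+\log K_{W^\flat}(e^{-\mathbb{U}}).$$ *Sinkhorn bridges.* Let $\mathcal{P}_0=P$ and, for $n\ge0$, let $\mathcal{P}_{2n+1}$ be a minimizer of $\mathcal{H}(\cdot\,|\,\mathcal{P}_{2n})$ over the probability measures with second marginal $\eta$, and $\mathcal{P}_{2(n+1)}$ a minimizer of $\mathcal{H}(\cdot\,|\,\mathcal{P}_{2n+1})$ over the probability measures with first marginal $\mu$ (with finite minima). Let $\mathcal{K}_{2n+1}$ be a Markov transition with $\mathcal{P}_{2n+1}(d(x,y))=\eta(dy)\,\mathcal{K}_{2n+1}(y,dx)$. Define the Sinkhorn potentials by $V_0=0$ and, for $n\ge0$, $$U_{2n}:=U+\log K_W(e^{-V_{2n}})=:U_{2n+1},\qquad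 V_{2n+1}:=V+\log K_{W^\flat}(e^{-U_{2n+1}})=:V_{2(n+1)}.$$ For a Markov transition $\mathcal{K}$ let $m_{\mathcal{K}}(y):=\int\mathcal{K}(y,dx)\,x$ and $\sigma_{\mathcal{K}}(y):=\int\mathcal{K}(y,dx)\,(x-m_{\mathcal{K}}(y))(x-m_{\mathcal{K}}(y))'$; write $m_{2n+1},\sigma_{2n+1}$ for $\mathcal{K}=\mathcal{K}_{2n+1}$ and $m_{\eta,\mu},\sigma_{\eta,\mu}$ for $\mathcal{K}=\mathcal{L}^\flat_{\eta,\mu}$. Let $\Vert\cdot\Vert_2$ be the spectral norm, $\Vert\cdot\Vert_F$ the Frobenius norm (the Euclidean norm for vectors), and $|||v|||_{p,\eta}^p:=\int\eta(dy)\,\Vert v(y)\Vert_F^p\in[0,\infty]$. Then for every $n\ge 0$ the integrals $K_W(e^{-V_{2n}})$ and $K_{W^\flat}(e^{-U_{2n+1}})$ are finite everywhere, the functions $V_{2n+1}$ and $\mathbb{V}$ are twice differentiable, for $\eta$-almost every $y$ the measures $\mathcal{K}_{2n+1}(y,\cdot)$ and $\mathcal{L}^\flat_{\eta,\mu}(y,\cdot)$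 have finite second moments, and $$|||\nabla V_{2n+1}-\nabla\mathbb{V}|||_{2,\eta}^2\le\Vert\chi\Vert_2^2\;|||m_{2n+1}-m_{\eta,\mu}|||_{2,\eta}^2,$$ $$|||\nabla^2 V_{2n+1}-\nabla^2\mathbb{V}|||_{1,\eta}\le\Vert\chi\Vert_2^2\;|||\sigma_{2n+1}-\sigma_{\eta,\mu}|||_{1,\eta}.$$ -/

import Mathlib

open MeasureTheory ProbabilityTheory InformationTheory
open scoped ENNReal Matrix

noncomputable section

namespace SinkhornBridge

/-- `ℝ^d` with its Euclidean norm. -/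
abbrev E (d : ℕ) := EuclideanSpace ℝ (Fin d)

variable {d : ℕ}

/-! ### Differential calculus and norms -/

/-- `f` is twice differentiable on the whole space. -/
def TwiceDifferentiable (f : E d → ℝ) : Prop :=
  Differentiable ℝ f ∧ Differentiable ℝ (gradient f)

/-- The Hessian matrix: the entry `(i, j)` is the `j`-th partial derivative of the `i`-th coordinate
of the gradient. -/
def hessian (f : E d → ℝ) (x : E d) : Matrix (Fin d) (Fin d) ℝ :=
  Matrix.of fun i j => (fderiv ℝ (gradient f) x (EuclideanSpace.single j 1)) i

/-- The spectral norm of a square matrix: the operator norm for the Euclidean norm. -/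
def spectralNorm₂ (v : Matrix (Fin d) (Fin d) ℝ) : ℝ :=
  ‖Matrix.toEuclideanCLM (𝕜 := ℝ) v‖

/-- The Frobenius norm `√Tr(v' v)`. -/
def frobeniusNorm (v : Matrix (Fin d) (Fin d) ℝ) : ℝ :=
  √((vᵀ * v).trace)

/-! ### Gibbs measures, Gibbs transitions and the linear Gaussian potential -/

/-- The measure `e^{-U(x)} λ(dx)`, with `λ` the Lebesgue measure. -/
def gibbsMeasure (U : E d → ℝ) : Measure (E d) :=
  volume.withDensity fun x => ENNReal.ofReal (Real.exp (-U x))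

/-- The transition `K_W(x, dy) = e^{-W(x,y)} λ(dy)`. -/
def gibbsKernel (W : E d → E d → ℝ) : Kernel (E d) (E d) :=
  Kernel.withDensity (Kernel.const (E d) volume)
    fun x y => ENNReal.ofReal (Real.exp (-W x y))

/-- The conjugate potential `W^♭(y, x) = W(x, y)`. -/
def conj (W : E d → E d → ℝ) : E d → E d → ℝ := fun y x => W x y

/-- The density `g_τ` of a centered Gaussian variable with covariance matrix `τ`. -/
def gaussianDensity (τ : Matrix (Fin d) (Fin d) ℝ) (z : E d) : ℝ :=
  (√((2 * Real.pi) ^ d * τ.det))⁻¹ *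
    Real.exp (-(inner ℝ z (Matrix.toEuclideanCLM (𝕜 := ℝ) τ⁻¹ z)) / 2)

/-- The linear Gaussian potential `W(x,y) = -log g_τ(y - (α + β x))`. -/
def gaussianPotential (α : E d) (β τ : Matrix (Fin d) (Fin d) ℝ) : E d → E d → ℝ :=
  fun x y => -Real.log (gaussianDensity τ (y - (α + Matrix.toEuclideanCLM (𝕜 := ℝ) β x)))

/-- The reference distribution `P = μ × K_W`, with `μ = e^{-U} λ`. -/
def referenceMeasure (U : E d → ℝ) (W : E d → E d → ℝ) : Measure (E d × E d) :=
  gibbsMeasure U ⊗ₘ gibbsKernel W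

/-! ### Schrödinger and Sinkhorn bridges -/

/-- `Q` minimises the relative entropy `H(· | R)` over the set `C`, with a finite minimum. -/
def IsEntropicProjection (C : Set (Measure (E d × E d))) (R Q : Measure (E d × E d)) : Prop :=
  Q ∈ C ∧ klDiv Q R ≠ ∞ ∧ ∀ Q' ∈ C, klDiv Q R ≤ klDiv Q' R

/-- Probability measures with first marginal `μ`. -/
def firstMarginal (μ : Measure (E d)) : Set (Measure (E d × E d)) :=
  {Q | IsProbabilityMeasure Q ∧ Q.fst = μ}

/-- Probability measures with second marginal `η`. -/
def secondMarginal (η : Measure (E d)) : Set (Measure (E d × E d)) :=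
  {Q | IsProbabilityMeasure Q ∧ Q.snd = η}

/-- `Q` is the Schrödinger bridge from `μ` to `η` with respect to the reference `R`. -/
def IsSchrodingerBridge (μ η : Measure (E d)) (R Q : Measure (E d × E d)) : Prop :=
  IsEntropicProjection (firstMarginal μ ∩ secondMarginal η) R Q

/-- `P` is the sequence of Sinkhorn bridges started at `R`, with target marginals `μ` and `η`. -/
structure IsSinkhornSequence (μ η : Measure (E d)) (R : Measure (E d × E d))
    (P : ℕ → Measure (E d × E d)) : Prop where
  zero : P 0 = R
  odd : ∀ n, IsEntropicProjection (secondMarginal η) (P (2 * n)) (P (2 * n + 1))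
  even : ∀ n, IsEntropicProjection (firstMarginal μ) (P (2 * n + 1)) (P (2 * (n + 1)))

/-- `K` disintegrates `P` with respect to the second coordinate: `P(d(x,y)) = η(dy) K(y, dx)`. -/
def IsBackwardTransition (η : Measure (E d)) (P : Measure (E d × E d))
    (K : Kernel (E d) (E d)) : Prop :=
  P.map Prod.swap = η ⊗ₘ K

/-! ### Conditional means and covariances -/

/-- The conditional mean `m_K(y) = ∫ K(y, dx) x`. -/
def condMean (K : Kernel (E d) (E d)) (y : E d) : E d := ∫ x, x ∂(K y)

/-- The conditional covariance matrix `σ_K(y) = ∫ K(y, dx) (x - m_K(y)) (x - m_K(y))'`. -/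
def condCov (K : Kernel (E d) (E d)) (y : E d) : Matrix (Fin d) (Fin d) ℝ :=
  Matrix.of fun i j => ∫ x, (x i - condMean K y i) * (x j - condMean K y j) ∂(K y)

/-! ### Sinkhorn and Schrödinger potentials -/

/-- The function `U + log K_W(e^{-f})`. -/
def potentialStep (U : E d → ℝ) (W : E d → E d → ℝ) (f : E d → ℝ) : E d → ℝ :=
  fun x => U x + Real.log (∫ y, Real.exp (-f y) ∂(gibbsKernel W x))

/-- The pair of Sinkhorn potentials `(U_n, V_n)`: with `V_0 = 0`,
`U_{2n} = U + log K_W(e^{-V_{2n}}) = U_{2n+1}` and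
`V_{2n+1} = V + log K_{W^♭}(e^{-U_{2n+1}}) = V_{2(n+1)}`. -/
def sinkhornPotentials (U V : E d → ℝ) (W : E d → E d → ℝ) : ℕ → (E d → ℝ) × (E d → ℝ)
  | 0 => (potentialStep U W 0, 0)
  | n + 1 =>
    let p := sinkhornPotentials U V W n
    if Even n then (p.1, potentialStep V (conj W) p.1) else (potentialStep U W p.2, p.2)

/-- The Sinkhorn potential `U_n`. -/
def sinkhornU (U V : E d → ℝ) (W : E d → E d → ℝ) (n : ℕ) : E d → ℝ :=
  (sinkhornPotentials U V W n).1

/-- The Sinkhorn potential `V_n`. -/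
def sinkhornV (U V : E d → ℝ) (W : E d → E d → ℝ) (n : ℕ) : E d → ℝ :=
  (sinkhornPotentials U V W n).2

/-- `(𝕌, 𝕍)` solves the Schrödinger system `𝕌 = U + log K_W(e^{-𝕍})`, `𝕍 = V + log K_{W^♭}(e^{-𝕌})`,
all integrals being finite. -/
structure IsSchrodingerPotentials (U V : E d → ℝ) (W : E d → E d → ℝ) (𝕌 𝕍 : E d → ℝ) : Prop where
  measurable_fst : Measurable 𝕌
  measurable_snd : Measurable 𝕍
  integrable_fst : ∀ y, Integrable (fun x => Real.exp (-𝕌 x)) (gibbsKernel (conj W) y)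
  integrable_snd : ∀ x, Integrable (fun y => Real.exp (-𝕍 y)) (gibbsKernel W x)
  eq_fst : 𝕌 = potentialStep U W 𝕍
  eq_snd : 𝕍 = potentialStep V (conj W) 𝕌

end SinkhornBridge

end

open SinkhornBridge

/-! Expanding the Gaussian exponent gives `W(x,y) = B(x) + A(y) - ⟨χ x, y⟩` with `A` quadratic.
Hence, for a coupling `e^{-(u(x) + W(x,y) + v(y))} dx dy`, the law of `x` given `y` is the measure
`e^{-(B+u)} dx` exponentially tilted by `w = χ'y`, and `V + log K_{W^♭}(e^{-u})` equals `V - A` plus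
the log-Laplace transform of that measure at `χ'y`. The gradient and Hessian of a log-Laplace
transform are the mean and covariance of the tilted measure, so the potential has gradient `∇V - ∇A
+ χ m(y)` and Hessian `∇²V - ∇²A + χ σ(y) χ'`. Both `V_{2n+1}` and `𝕍` have this form, with
different `u`; in their difference the terms in `V` and `A` cancel, and the estimates reduce to `‖χ
m‖ ≤ ‖χ‖₂ ‖m‖` and `‖χ σ χ'‖_F ≤ ‖χ‖₂² ‖σ‖_F`.

Two points need work. The bridges are given only as entropy minimisers and must be identified with
these Gibbs couplings (`eq_of_klDiv_le`). If `S = e^{a+b} M` is the candidate, with `a`, `b`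
functions of one coordinate each, then formally `H(Q|S) = H(Q|M) - ∫(a+b) dQ = H(Q|M) - H(S|M) ≤ 0`.
Neither `a` nor `b` need be integrable, so `∫(a+b) dQ = ∫(a+b) dS` is proved by truncation
(`integral_add_eq_of_map_eq`).

Secondly, the integrals must be finite everywhere. Fubini gives this almost everywhere, and
convexity of the domain of a Laplace transform removes the exceptional set
(`IsBilinearPotential.integrable_of_ae`). Since `χ` is invertible, `χ'y` covers all of `ℝ^d`, so the
Laplace transform is finite everywhere and can be differentiated under the integral. -/

/-! ### Truncation, sums with prescribed marginal laws, and identification of entropy minimisers -/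

open Filter Topology in
/-- Fatou's lemma for a sum of two integrals. -/
lemma lintegral_add_lintegral_le_of_tendsto {Ω Ω' : Type*} [MeasurableSpace Ω] [MeasurableSpace Ω']
    {μ : Measure Ω} {ν : Measure Ω'} {f : ℕ → Ω → ℝ≥0∞} {F : Ω → ℝ≥0∞} {g : ℕ → Ω' → ℝ≥0∞}
    {G : Ω' → ℝ≥0∞} {C : ℝ≥0∞} (hf : ∀ n, Measurable (f n)) (hg : ∀ n, Measurable (g n))
    (hfF : ∀ x, Tendsto (fun n => f n x) atTop (𝓝 (F x)))
    (hgG : ∀ x, Tendsto (fun n => g n x) atTop (𝓝 (G x)))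
    (hC : ∀ n, ∫⁻ x, f n x ∂μ + ∫⁻ x, g n x ∂ν ≤ C) :
    ∫⁻ x, F x ∂μ ≤ C ∧ ∫⁻ x, G x ∂ν ≤ C := by
  constructor
  · have : F = fun x => liminf (fun n => f n x) atTop := funext fun x => (hfF x).liminf_eq.symm
    rw [this]
    refine (lintegral_liminf_le hf).trans ?_
    refine liminf_le_of_le (by isBoundedDefault) fun b hb => ?_
    obtain ⟨n, hn⟩ := hb.exists
    exact hn.trans (le_self_add.trans (hC n))
  · have : G = fun x => liminf (fun n => g n x) atTop := funext fun x => (hgG x).liminf_eq.symm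
    rw [this]
    refine (lintegral_liminf_le hg).trans ?_
    refine liminf_le_of_le (by isBoundedDefault) fun b hb => ?_
    obtain ⟨n, hn⟩ := hb.exists
    exact hn.trans (le_add_self.trans (hC n))

/-- Truncation of a real number at levels `-n` and `n`. -/
def truncateAt (n : ℕ) (t : ℝ) : ℝ := max (-n) (min t n)

lemma measurable_truncateAt (n : ℕ) : Measurable (truncateAt n) := by
  unfold truncateAt; fun_prop

lemma abs_truncateAt_le (n : ℕ) (t : ℝ) : |truncateAt n t| ≤ n := by
  have : (0 : ℝ) ≤ n := n.cast_nonneg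
  unfold truncateAt
  rw [abs_le]
  exact ⟨le_max_left _ _, max_le (by linarith) (min_le_right _ _)⟩

lemma truncateAt_eq_self {n : ℕ} {t : ℝ} (h : |t| ≤ n) : truncateAt n t = t := by
  rw [abs_le] at h
  rw [truncateAt, min_eq_left h.2, max_eq_right h.1]

/-- Truncation at symmetric levels is odd, nondecreasing and 1-Lipschitz, so `T s + T t = T s - T
(-t)` has the sign of `s + t` (or vanishes) and is no larger in absolute value. -/
lemma max_truncateAt_add_le (n : ℕ) (s t : ℝ) :
    max (truncateAt n s + truncateAt n t) 0 ≤ max (s + t) 0 := by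
  have : (0 : ℝ) ≤ n := n.cast_nonneg
  unfold truncateAt
  grind

lemma max_neg_truncateAt_add_le (n : ℕ) (s t : ℝ) :
    max (-(truncateAt n s + truncateAt n t)) 0 ≤ max (-(s + t)) 0 := by
  have : (0 : ℝ) ≤ n := n.cast_nonneg
  unfold truncateAt
  grind

open Filter Topology in
lemma tendsto_truncateAt (t : ℝ) : Tendsto (fun n => truncateAt n t) atTop (𝓝 t) := by
  refine tendsto_const_nhds.congr' ?_
  obtain ⟨N, hN⟩ := exists_nat_ge |t|
  filter_upwards [eventually_ge_atTop N] with n hn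
  exact (truncateAt_eq_self (hN.trans (by exact_mod_cast hn))).symm

open Filter Topology in
/-- A sum `a + b` has the same integral under two measures that give the same laws to `a` and to
`b`, as soon as its positive part is integrable under one of them and its negative part under the
other. No integrability of `a` or `b` alone is required. -/
lemma integral_add_eq_of_map_eq {Ω : Type*} [MeasurableSpace Ω] {μ ν : Measure Ω}
    [IsProbabilityMeasure μ] [IsProbabilityMeasure ν] {a b : Ω → ℝ} (ha : Measurable a)
    (hb : Measurable b) (hma : μ.map a = ν.map a) (hmb : μ.map b = ν.map b)
    (hpos : ∫⁻ x, ENNReal.ofReal (a x + b x) ∂μ ≠ ∞)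
    (hneg : ∫⁻ x, ENNReal.ofReal (-(a x + b x)) ∂ν ≠ ∞) :
    Integrable (fun x => a x + b x) μ ∧ Integrable (fun x => a x + b x) ν ∧
      ∫ x, (a x + b x) ∂μ = ∫ x, (a x + b x) ∂ν := by
  have hm : Measurable fun x => a x + b x := ha.add hb
  set h : ℕ → Ω → ℝ := fun n x => truncateAt n (a x) + truncateAt n (b x) with hh
  have hhm : ∀ n, Measurable (h n) := fun n =>
    ((measurable_truncateAt n).comp ha).add ((measurable_truncateAt n).comp hb)
  have hbd : ∀ (n : ℕ) (f : Ω → ℝ) (_ : Measurable f) (ρ : Measure Ω) [IsProbabilityMeasure ρ],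
      Integrable (fun x => truncateAt n (f x)) ρ := fun n f hf ρ _ =>
    Integrable.of_bound ((measurable_truncateAt n).comp hf).aestronglyMeasurable n
      (ae_of_all _ fun x => abs_truncateAt_le n _)
  have hint : ∀ n (ρ : Measure Ω) [IsProbabilityMeasure ρ], Integrable (h n) ρ := fun n ρ _ =>
    (hbd n a ha ρ).add (hbd n b hb ρ)
  have hmapeq : ∀ (n : ℕ) (f : Ω → ℝ), Measurable f → μ.map f = ν.map f →
      ∫ x, truncateAt n (f x) ∂μ = ∫ x, truncateAt n (f x) ∂ν := fun n f hf hfe => by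
    rw [← integral_map (φ := f) hf.aemeasurable (measurable_truncateAt n).aestronglyMeasurable, hfe,
      integral_map hf.aemeasurable (measurable_truncateAt n).aestronglyMeasurable]
  have heq : ∀ n, ∫ x, h n x ∂μ = ∫ x, h n x ∂ν := fun n => by
    simp only [hh]
    rw [integral_add (hbd n a ha μ) (hbd n b hb μ), integral_add (hbd n a ha ν) (hbd n b hb ν),
      hmapeq n a ha hma, hmapeq n b hb hmb]
  have hofpos : ∀ n x, ENNReal.ofReal (h n x) ≤ ENNReal.ofReal (a x + b x) := fun n x => by
    simpa [ENNReal.ofReal_max] using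
      ENNReal.ofReal_le_ofReal (max_truncateAt_add_le n (a x) (b x))
  have hofneg : ∀ n x, ENNReal.ofReal (-h n x) ≤ ENNReal.ofReal (-(a x + b x)) := fun n x => by
    simpa only [ENNReal.ofReal_max, ENNReal.ofReal_zero, zero_le, sup_of_le_left] using
      ENNReal.ofReal_le_ofReal (max_neg_truncateAt_add_le n (a x) (b x))
  have htend : ∀ x, Tendsto (fun n => h n x) atTop (𝓝 (a x + b x)) := fun x =>
    (tendsto_truncateAt _).add (tendsto_truncateAt _)
  have hfin : ∀ n (ρ : Measure Ω) [IsProbabilityMeasure ρ],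
      ∫⁻ x, ENNReal.ofReal (h n x) ∂ρ ≠ ∞ ∧ ∫⁻ x, ENNReal.ofReal (-h n x) ∂ρ ≠ ∞ := fun n ρ _ =>
    ⟨(hint n ρ).lintegral_lt_top.ne, (hint n ρ).neg.lintegral_lt_top.ne⟩
  -- The equality of integrals is rearranged so that the right side holds exactly the two parts
  -- controlled by `hpos` and `hneg`; Fatou then bounds the two uncontrolled parts on the left.
  have hswap : ∀ n, ∫⁻ x, ENNReal.ofReal (-h n x) ∂μ + ∫⁻ x, ENNReal.ofReal (h n x) ∂ν
      = ∫⁻ x, ENNReal.ofReal (h n x) ∂μ + ∫⁻ x, ENNReal.ofReal (-h n x) ∂ν := fun n => by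
    have := heq n
    rw [integral_eq_lintegral_pos_part_sub_lintegral_neg_part (hint n μ),
      integral_eq_lintegral_pos_part_sub_lintegral_neg_part (hint n ν)] at this
    have h1 := hfin n μ
    have h2 := hfin n ν
    rw [← ENNReal.toReal_eq_toReal_iff' (by simp [h1, h2]) (by simp [h1, h2]),
      ENNReal.toReal_add h1.2 h2.1, ENNReal.toReal_add h1.1 h2.2]
    linarith
  have hC : ∀ n, ∫⁻ x, ENNReal.ofReal (-h n x) ∂μ + ∫⁻ x, ENNReal.ofReal (h n x) ∂ν
      ≤ ∫⁻ x, ENNReal.ofReal (a x + b x) ∂μ + ∫⁻ x, ENNReal.ofReal (-(a x + b x)) ∂ν := fun n => by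
    rw [hswap n]
    exact add_le_add (lintegral_mono (hofpos n)) (lintegral_mono (hofneg n))
  obtain ⟨hneg', hpos'⟩ := lintegral_add_lintegral_le_of_tendsto
    (fun n => (hhm n).neg.ennreal_ofReal) (fun n => (hhm n).ennreal_ofReal)
    (fun x => (ENNReal.continuous_ofReal.tendsto _).comp (htend x).neg)
    (fun x => (ENNReal.continuous_ofReal.tendsto _).comp (htend x)) hC
  have hC' := ENNReal.add_ne_top.2 ⟨hpos, hneg⟩
  have hI : ∀ ρ : Measure Ω, ∫⁻ x, ENNReal.ofReal (a x + b x) ∂ρ ≠ ∞ →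
      ∫⁻ x, ENNReal.ofReal (-(a x + b x)) ∂ρ ≠ ∞ → Integrable (fun x => a x + b x) ρ :=
    fun ρ h1 h2 => by
      refine ⟨hm.aestronglyMeasurable, ?_⟩
      rw [hasFiniteIntegral_iff_norm]
      calc ∫⁻ x, ENNReal.ofReal ‖a x + b x‖ ∂ρ
          ≤ ∫⁻ x, (ENNReal.ofReal (a x + b x) + ENNReal.ofReal (-(a x + b x))) ∂ρ := by
            refine lintegral_mono fun x => ?_
            rcases le_total 0 (a x + b x) with h0 | h0
            · rw [Real.norm_of_nonneg h0]; exact le_self_add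
            · rw [Real.norm_of_nonpos h0]; exact le_add_self
        _ = _ := lintegral_add_left hm.ennreal_ofReal _
        _ < ∞ := ENNReal.add_lt_top.2 ⟨h1.lt_top, h2.lt_top⟩
  have hIμ := hI μ hpos (ne_top_of_le_ne_top hC' hneg')
  have hIν := hI ν (ne_top_of_le_ne_top hC' hpos') hneg
  refine ⟨hIμ, hIν, ?_⟩
  have hdom : ∀ n x, ‖h n x‖ ≤ ‖a x + b x‖ := fun n x => by
    have h1 := max_truncateAt_add_le n (a x) (b x)
    have h2 := max_neg_truncateAt_add_le n (a x) (b x)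
    simp only [hh, Real.norm_eq_abs]
    grind
  have hlim : ∀ ρ : Measure Ω, Integrable (fun x => a x + b x) ρ →
      Tendsto (fun n => ∫ x, h n x ∂ρ) atTop (𝓝 (∫ x, (a x + b x) ∂ρ)) := fun ρ hρ =>
    tendsto_integral_of_dominated_convergence (fun x => ‖a x + b x‖)
      (fun n => (hhm n).aestronglyMeasurable) hρ.norm (fun n => ae_of_all _ (hdom n))
      (ae_of_all _ htend)
  exact tendsto_nhds_unique (hlim μ hIμ) ((hlim ν hIν).congr fun n => (heq n).symm)

/-- The positive part of the logarithm of a probability density with respect to `M` is integrable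
under every probability measure of finite entropy relative to `M`. -/
lemma lintegral_ofReal_ne_top_of_klDiv_ne_top {Ω : Type*} [MeasurableSpace Ω] {M Q : Measure Ω}
    [IsProbabilityMeasure M] [IsProbabilityMeasure Q] {h : Ω → ℝ} (hm : Measurable h)
    (hR : ∫⁻ x, ENNReal.ofReal (Real.exp (h x)) ∂M ≠ ∞) (hQ : klDiv Q M ≠ ∞) :
    ∫⁻ x, ENNReal.ofReal (h x) ∂Q ≠ ∞ := by
  obtain ⟨hac, hint⟩ := klDiv_ne_top_iff.1 hQ
  -- With `ℓ = llr Q M` and `dM/dQ = e^{-ℓ}`, the inequality `t + 1 ≤ e^t` at `t = h - ℓ` gives `h ≤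
  -- ℓ + e^h dM/dQ`. Integrating the last term under `Q` costs at most `∫ e^h dM`.
  have hpt : ∀ᵐ x ∂Q, ENNReal.ofReal (h x) ≤ ENNReal.ofReal ‖llr Q M x‖ +
      (1 + ENNReal.ofReal (Real.exp (h x))) * M.rnDeriv Q x := by
    filter_upwards [exp_neg_llr hac, Measure.rnDeriv_ne_top M Q] with x hx hx'
    rw [← ENNReal.ofReal_toReal hx', ← hx, ← ENNReal.ofReal_one,
      ← ENNReal.ofReal_add zero_le_one (Real.exp_pos _).le, ← ENNReal.ofReal_mul (by positivity),
      ← ENNReal.ofReal_add (by positivity) (by positivity)]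
    apply ENNReal.ofReal_le_ofReal
    have h1 : Real.exp (h x) * Real.exp (-llr Q M x) = Real.exp (h x - llr Q M x) := by
      rw [← Real.exp_add, sub_eq_add_neg]
    have h2 := Real.add_one_le_exp (h x - llr Q M x)
    have h3 := Real.exp_pos (-llr Q M x)
    have h4 := le_abs_self (llr Q M x)
    rw [Real.norm_eq_abs]
    nlinarith
  refine ne_top_of_le_ne_top ?_ (lintegral_mono_ae hpt)
  rw [lintegral_add_left (by fun_prop)]
  refine ENNReal.add_ne_top.2 ⟨?_, ?_⟩
  · exact ((hasFiniteIntegral_iff_norm _).1 hint.2).ne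
  · have : ∫⁻ x, (1 + ENNReal.ofReal (Real.exp (h x))) * M.rnDeriv Q x ∂Q
        ≤ ∫⁻ x, (1 + ENNReal.ofReal (Real.exp (h x))) ∂M := by
      simp_rw [mul_comm _ (M.rnDeriv Q _)]
      refine (lintegral_withDensity_eq_lintegral_mul Q (Measure.measurable_rnDeriv M Q)
        (g := fun x => 1 + ENNReal.ofReal (Real.exp (h x))) (by fun_prop)).symm.le.trans ?_
      exact lintegral_mono' (Measure.withDensity_rnDeriv_le M Q) le_rfl
    refine ne_top_of_le_ne_top ?_ this
    rw [lintegral_add_left measurable_const]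
    simp [hR]

/-- If a probability measure `S` has density `e^{a + b}` with respect to `M`, any measure of finite
entropy that gives the same laws to `a` and `b` as `S`, and has at most the entropy of `S`, is `S`. -/
theorem eq_of_klDiv_le {Ω : Type*} [MeasurableSpace Ω] {M Q S : Measure Ω}
    [IsProbabilityMeasure M] [IsProbabilityMeasure Q] [IsProbabilityMeasure S] {a b : Ω → ℝ}
    (ha : Measurable a) (hb : Measurable b)
    (hS : S = M.withDensity fun x => ENNReal.ofReal (Real.exp (a x + b x)))
    (hma : Q.map a = S.map a) (hmb : Q.map b = S.map b)
    (hfin : klDiv Q M ≠ ∞) (hle : klDiv Q M ≤ klDiv S M) : Q = S := by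
  have hm : Measurable fun x => a x + b x := ha.add hb
  have hone : ∫⁻ x, ENNReal.ofReal (Real.exp (a x + b x)) ∂M = 1 := by
    rw [← setLIntegral_univ, ← withDensity_apply _ MeasurableSet.univ, ← hS, measure_univ]
  have hexp : Integrable (fun x => Real.exp (a x + b x)) M := by
    refine ⟨hm.exp.aestronglyMeasurable, ?_⟩
    rw [hasFiniteIntegral_iff_ofReal (ae_of_all _ fun x => (Real.exp_pos _).le), hone]
    exact ENNReal.one_lt_top
  have hZ : ∫ x, Real.exp (a x + b x) ∂M = 1 := by
    rw [integral_eq_lintegral_of_nonneg_ae (ae_of_all _ fun x => (Real.exp_pos _).le)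
      hm.exp.aestronglyMeasurable, hone, ENNReal.toReal_one]
  have hSt : S = M.tilted fun x => a x + b x := by
    rw [hS, Measure.tilted]
    simp [hZ]
  have hpos := lintegral_ofReal_ne_top_of_klDiv_ne_top hm (by simp [hone]) hfin
  -- Under `S` the density is `e^t` with `t = a + b`, and `-t e^t ≤ 1`.
  have hneg : ∫⁻ x, ENNReal.ofReal (-(a x + b x)) ∂S ≠ ∞ := by
    have : ∫⁻ x, ENNReal.ofReal (-(a x + b x)) ∂S ≤ ∫⁻ _, 1 ∂M := by
      rw [hS, lintegral_withDensity_eq_lintegral_mul _ (by fun_prop) (by fun_prop)]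
      refine lintegral_mono fun x => ?_
      simp only [Pi.mul_apply]
      rw [← ENNReal.ofReal_mul (Real.exp_pos _).le, ← ENNReal.ofReal_one]
      apply ENNReal.ofReal_le_ofReal
      have h1 := Real.add_one_le_exp (-(a x + b x))
      have h2 : Real.exp (a x + b x) * Real.exp (-(a x + b x)) = 1 := by
        rw [← Real.exp_add]; simp
      have h3 := Real.exp_pos (a x + b x)
      nlinarith
    exact ne_top_of_le_ne_top (by simp) this
  obtain ⟨hIQ, hIS, hIeq⟩ := integral_add_eq_of_map_eq ha hb hma hmb hpos hneg
  obtain ⟨hac, hint⟩ := klDiv_ne_top_iff.1 hfin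
  have hSR : S ≪ M := hSt ▸ tilted_absolutelyContinuous M _
  have hRS : M ≪ S := hSt ▸ absolutelyContinuous_tilted hexp
  have hllr : llr S M =ᵐ[S] fun x => a x + b x := by
    refine hSR.ae_le ?_
    have := log_rnDeriv_tilted_left_self hexp
    rw [hSt]
    filter_upwards [this] with x hx
    rw [llr, hx, hZ, Real.log_one, sub_zero]
  have hllrS : Integrable (llr S M) S := hIS.congr hllr.symm
  -- Passing to real values needs `klDiv S M` finite; this is not assumed, but follows from the
  -- `S`-integrability of `a + b` just obtained.
  have hle' : ∫ x, llr Q M x ∂Q ≤ ∫ x, llr S M x ∂S := by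
    rw [← toReal_klDiv_of_measure_eq hac (by simp), ← toReal_klDiv_of_measure_eq hSR (by simp)]
    exact ENNReal.toReal_mono (klDiv_ne_top hSR hllrS) hle
  have hQS : Integrable (llr Q S) Q := hSt ▸ integrable_llr_tilted_right hac hIQ hint hexp
  have hQSi : ∫ x, llr Q S x ∂Q = ∫ x, llr Q M x ∂Q - ∫ x, (a x + b x) ∂Q := by
    rw [hSt, integral_llr_tilted_right hac hIQ hexp hint, hZ, Real.log_one, add_zero]
  have hzero : klDiv Q S = 0 := by
    have h1 := toReal_klDiv_of_measure_eq (hac.trans hRS) (by simp : Q Set.univ = S Set.univ)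
    have h2 := ENNReal.toReal_nonneg (a := klDiv Q S)
    rw [integral_congr_ae hllr] at hle'
    have h3 : (klDiv Q S).toReal = 0 := by linarith
    exact (ENNReal.toReal_eq_zero_iff _).1 h3 |>.resolve_right
      (klDiv_ne_top (hac.trans hRS) hQS)
  exact klDiv_eq_zero_iff.1 hzero

/-! ### Bilinear potentials and Gibbs couplings -/

namespace SinkhornBridge

variable {d : ℕ}

/-- `W(x, y) = B(x) + A(y) - ⟨T x, y⟩` with measurable `A` and `B`. -/
structure IsBilinearPotential (W : E d → E d → ℝ) (B A : E d → ℝ) (T : E d →L[ℝ] E d) : Prop where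
  measurable_left : Measurable B
  measurable_right : Measurable A
  eq : ∀ x y, W x y = B x + A y - inner ℝ (T x) y

namespace IsBilinearPotential

variable {W : E d → E d → ℝ} {A B : E d → ℝ} {T : E d →L[ℝ] E d}

lemma conjugate (h : IsBilinearPotential W B A T) :
    IsBilinearPotential (conj W) A B T.adjoint :=
  ⟨h.measurable_right, h.measurable_left, fun y x => by
    rw [conj, h.eq, ContinuousLinearMap.adjoint_inner_left, real_inner_comm]
    ring⟩

lemma measurable (h : IsBilinearPotential W B A T) : Measurable (Function.uncurry W) := by
  have h1 := h.measurable_left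
  have h2 := h.measurable_right
  have : Function.uncurry W = fun p => B p.1 + A p.2 - inner ℝ (T p.1) p.2 :=
    funext fun p => h.eq p.1 p.2
  rw [this]
  fun_prop

end IsBilinearPotential

lemma measurable_ofReal_exp_neg {W : E d → E d → ℝ} (hW : Measurable (Function.uncurry W)) :
    Measurable (Function.uncurry fun x y => ENNReal.ofReal (Real.exp (-W x y))) :=
  hW.neg.exp.ennreal_ofReal

instance isSFiniteKernel_gibbsKernel (W : E d → E d → ℝ) : IsSFiniteKernel (gibbsKernel W) :=
  Kernel.IsSFiniteKernel.withDensity _ fun _ _ => ENNReal.ofReal_ne_top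

instance sFinite_gibbsMeasure (U : E d → ℝ) : SFinite (gibbsMeasure U) := by
  unfold gibbsMeasure; infer_instance

lemma gibbsKernel_apply {W : E d → E d → ℝ} (hW : Measurable (Function.uncurry W)) (x : E d) :
    gibbsKernel W x = volume.withDensity fun y => ENNReal.ofReal (Real.exp (-W x y)) := by
  rw [gibbsKernel, Kernel.withDensity_apply _ (measurable_ofReal_exp_neg hW), Kernel.const_apply]

lemma integrable_gibbsKernel_iff {W : E d → E d → ℝ} (hW : Measurable (Function.uncurry W))
    (v : E d → ℝ) (x : E d) : Integrable (fun y => Real.exp (-v y)) (gibbsKernel W x) ↔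
      Integrable fun y => Real.exp (-(W x y + v y)) := by
  have hWx : Measurable (W x) := hW.of_uncurry_left
  rw [gibbsKernel_apply hW, integrable_withDensity_iff_integrable_smul' (by fun_prop) (by simp)]
  refine integrable_congr (ae_of_all _ fun y => ?_)
  simp only [smul_eq_mul]
  rw [ENNReal.toReal_ofReal (Real.exp_pos _).le, ← Real.exp_add, neg_add]

lemma integral_gibbsKernel {W : E d → E d → ℝ} (hW : Measurable (Function.uncurry W))
    (v : E d → ℝ) (x : E d) :
    ∫ y, Real.exp (-v y) ∂(gibbsKernel W x) = ∫ y, Real.exp (-(W x y + v y)) := by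
  have hWx : Measurable (W x) := hW.of_uncurry_left
  rw [gibbsKernel_apply hW, integral_withDensity_eq_integral_toReal_smul (by fun_prop) (by simp)]
  refine integral_congr_ae (ae_of_all _ fun y => ?_)
  simp only [smul_eq_mul]
  rw [ENNReal.toReal_ofReal (Real.exp_pos _).le, ← Real.exp_add, neg_add]

lemma measurable_potentialStep {U v : E d → ℝ} {W : E d → E d → ℝ} (hU : Measurable U)
    (hv : Measurable v) : Measurable (potentialStep U W v) := by
  refine hU.add (Measurable.log ?_)
  exact (StronglyMeasurable.integral_kernel
    (hv.neg.exp.stronglyMeasurable)).measurable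

/-- The measure `e^{-(u(x) + W(x, y) + v(y))} dx dy`. -/
noncomputable def jointMeasure (u v : E d → ℝ) (W : E d → E d → ℝ) : Measure (E d × E d) :=
  ((volume : Measure (E d)).prod volume).withDensity fun p =>
    ENNReal.ofReal (Real.exp (-(u p.1 + W p.1 p.2 + v p.2)))

lemma gibbsMeasure_compProd_gibbsKernel {U : E d → ℝ} {W : E d → E d → ℝ} (hU : Measurable U)
    (hW : Measurable (Function.uncurry W)) :
    gibbsMeasure U ⊗ₘ gibbsKernel W = jointMeasure U 0 W := by
  have hW' : Measurable fun p : E d × E d => W p.1 p.2 := hW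
  have : IsSFiniteKernel (Kernel.withDensity (Kernel.const (E d) (volume : Measure (E d)))
      fun x y => ENNReal.ofReal (Real.exp (-W x y))) := isSFiniteKernel_gibbsKernel W
  rw [gibbsKernel, Measure.compProd_withDensity (measurable_ofReal_exp_neg hW),
    Measure.compProd_const, gibbsMeasure, prod_withDensity_left (by fun_prop),
    ← withDensity_mul _ (by fun_prop) (by fun_prop), jointMeasure]
  congr 1
  ext p
  simp only [Pi.mul_apply, Pi.zero_apply, add_zero]
  rw [← ENNReal.ofReal_mul (Real.exp_pos _).le, ← Real.exp_add, neg_add]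

lemma jointMeasure_map_swap {u v : E d → ℝ} {W : E d → E d → ℝ} (hu : Measurable u)
    (hv : Measurable v) (hW : Measurable (Function.uncurry W)) :
    (jointMeasure u v W).map Prod.swap = jointMeasure v u (conj W) := by
  have hW' : Measurable fun p : E d × E d => W p.1 p.2 := hW
  have hW'' : Measurable fun p : E d × E d => W p.2 p.1 := hW'.comp measurable_swap
  ext s hs
  rw [Measure.map_apply measurable_swap hs, jointMeasure, jointMeasure,
    withDensity_apply _ (measurable_swap hs), withDensity_apply _ hs,
    ← Measure.prod_swap (μ := (volume : Measure (E d))) (ν := (volume : Measure (E d))),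
    setLIntegral_map hs (by unfold conj; fun_prop) measurable_swap]
  rw [Measure.prod_swap]
  refine lintegral_congr fun p => ?_
  simp only [Prod.fst_swap, Prod.snd_swap, conj]
  congr 3
  ring

/-- The normalised transition `e^{U - u} K_W(x, dy) e^{-v(y)}` with `u = U + log K_W(e^{-v})`. -/
noncomputable def normalizedKernel (U u v : E d → ℝ) (W : E d → E d → ℝ) : Kernel (E d) (E d) :=
  gibbsKernel fun x y => u x - U x + W x y + v y

section

variable {U u v : E d → ℝ} {W : E d → E d → ℝ}

lemma measurable_normalizedKernel (hU : Measurable U) (hu : Measurable u) (hv : Measurable v)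
    (hW : Measurable (Function.uncurry W)) :
    Measurable (Function.uncurry fun x y => u x - U x + W x y + v y) := by
  have hW' : Measurable fun p : E d × E d => W p.1 p.2 := hW
  unfold Function.uncurry
  fun_prop

lemma exp_potentialStep_sub (hW : Measurable (Function.uncurry W))
    (hint : ∀ x, Integrable (fun y => Real.exp (-v y)) (gibbsKernel W x)) (x : E d) :
    Real.exp (potentialStep U W v x - U x) = ∫ y, Real.exp (-(W x y + v y)) := by
  rw [potentialStep, add_sub_cancel_left, integral_gibbsKernel hW, Real.exp_log]
  -- Integrability matters: otherwise the integral is 0 by convention and `log 0 = 0` breaks the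
  -- identity.
  exact integral_exp_pos ((integrable_gibbsKernel_iff hW v x).1 (hint x))

lemma isMarkovKernel_normalizedKernel (hU : Measurable U) (hv : Measurable v)
    (hW : Measurable (Function.uncurry W))
    (hint : ∀ x, Integrable (fun y => Real.exp (-v y)) (gibbsKernel W x))
    (hu : u = potentialStep U W v) : IsMarkovKernel (normalizedKernel U u v W) := by
  have hum : Measurable u := hu ▸ measurable_potentialStep hU hv
  refine ⟨fun x => ⟨?_⟩⟩
  rw [normalizedKernel, gibbsKernel_apply (measurable_normalizedKernel hU hum hv hW),
    withDensity_apply _ MeasurableSet.univ, setLIntegral_univ]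
  have hi := (integrable_gibbsKernel_iff hW v x).1 (hint x)
  have h1 : ∀ y, Real.exp (-(u x - U x + W x y + v y))
      = (Real.exp (u x - U x))⁻¹ * Real.exp (-(W x y + v y)) := fun y => by
    rw [← Real.exp_neg, ← Real.exp_add]; ring_nf
  simp_rw [h1]
  rw [← ofReal_integral_eq_lintegral_ofReal (hi.const_mul _)
    (ae_of_all _ fun y => by positivity), integral_const_mul, hu, exp_potentialStep_sub hW hint,
    inv_mul_cancel₀ (integral_exp_pos hi).ne', ENNReal.ofReal_one]

/-- The factor `e^{U - u}` is moved into the transition. No equation between `u` and `v` is needed;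
such an equation only makes the transition Markov. -/
lemma jointMeasure_eq_compProd (hU : Measurable U) (hu : Measurable u) (hv : Measurable v)
    (hW : Measurable (Function.uncurry W)) :
    jointMeasure u v W = gibbsMeasure U ⊗ₘ normalizedKernel U u v W := by
  rw [normalizedKernel,
    gibbsMeasure_compProd_gibbsKernel hU (measurable_normalizedKernel hU hu hv hW), jointMeasure,
    jointMeasure]
  congr! 5
  simp only [Pi.zero_apply]
  ring

/-- If `u = U + log K_W(e^{-v})`, then `e^{-(u + W + v)}` is a coupling with first marginal
`e^{-U}`. -/
lemma jointMeasure_mem_firstMarginal (hU : Measurable U) (hv : Measurable v)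
    (hW : Measurable (Function.uncurry W)) (hμ : IsProbabilityMeasure (gibbsMeasure U))
    (hint : ∀ x, Integrable (fun y => Real.exp (-v y)) (gibbsKernel W x))
    (hu : u = potentialStep U W v) : jointMeasure u v W ∈ firstMarginal (gibbsMeasure U) := by
  have := isMarkovKernel_normalizedKernel hU hv hW hint hu
  rw [jointMeasure_eq_compProd hU (hu ▸ measurable_potentialStep hU hv) hv hW]
  exact ⟨inferInstance, Measure.fst_compProd _ _⟩

lemma jointMeasure_mem_secondMarginal {V : E d → ℝ} (hV : Measurable V) (hu : Measurable u)
    (hW : Measurable (Function.uncurry W)) (hη : IsProbabilityMeasure (gibbsMeasure V))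
    (hint : ∀ y, Integrable (fun x => Real.exp (-u x)) (gibbsKernel (conj W) y))
    (hv : v = potentialStep V (conj W) u) :
    jointMeasure u v W ∈ secondMarginal (gibbsMeasure V) := by
  have hW' : Measurable (Function.uncurry (conj W)) := hW.comp measurable_swap
  have hvm : Measurable v := hv ▸ measurable_potentialStep hV hu
  obtain ⟨h1, h2⟩ := jointMeasure_mem_firstMarginal hV hu hW' hη hint hv
  have h3 : jointMeasure u v W = (jointMeasure v u (conj W)).map Prod.swap := by
    rw [jointMeasure_map_swap hvm hu hW']; rfl
  rw [h3]
  exact ⟨Measure.isProbabilityMeasure_map measurable_swap.aemeasurable, by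
    rw [Measure.snd_map_swap, h2]⟩

/-- The density of `e^{-(u' + W + v')}` relative to `e^{-(u + W + v)}`. -/
lemma jointMeasure_withDensity {u' v' : E d → ℝ} (hu : Measurable u) (hv : Measurable v)
    (hu' : Measurable u') (hv' : Measurable v') (hW : Measurable (Function.uncurry W)) :
    jointMeasure u' v' W = (jointMeasure u v W).withDensity fun p =>
      ENNReal.ofReal (Real.exp ((u p.1 - u' p.1) + (v p.2 - v' p.2))) := by
  have hW' : Measurable fun p : E d × E d => W p.1 p.2 := hW
  rw [jointMeasure, jointMeasure, ← withDensity_mul _ (by fun_prop) (by fun_prop)]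
  congr 1
  ext p
  simp only [Pi.mul_apply]
  rw [← ENNReal.ofReal_mul (Real.exp_pos _).le, ← Real.exp_add]
  congr 2
  ring

/-- A measure of minimal entropy relative to `e^{-(u + W + v)}` among couplings with one or two
prescribed marginals is `e^{-(u' + W + v')}` as soon as the latter is such a coupling and only the
potentials of prescribed marginals have changed. -/
lemma IsEntropicProjection.eq_jointMeasure {C : Set (Measure (E d × E d))} {u' v' : E d → ℝ}
    {Q : Measure (E d × E d)} (hu : Measurable u) (hv : Measurable v)
    (hu' : Measurable u') (hv' : Measurable v') (hW : Measurable (Function.uncurry W))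
    (hQ : IsEntropicProjection C (jointMeasure u v W) Q)
    (hp : IsProbabilityMeasure (jointMeasure u v W)) (hpQ : IsProbabilityMeasure Q)
    (hC : jointMeasure u' v' W ∈ C) (hp' : IsProbabilityMeasure (jointMeasure u' v' W))
    (h1 : u' = u ∨ Q.fst = (jointMeasure u' v' W).fst)
    (h2 : v' = v ∨ Q.snd = (jointMeasure u' v' W).snd) : Q = jointMeasure u' v' W := by
  refine eq_of_klDiv_le (M := jointMeasure u v W) (a := fun p => u p.1 - u' p.1)
    (b := fun p => v p.2 - v' p.2) (by fun_prop) (by fun_prop)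
    (jointMeasure_withDensity hu hv hu' hv' hW) ?_ ?_ hQ.2.1 (hQ.2.2 _ hC)
  -- If a potential is unchanged, its difference is the constant 0, with the same law under every
  -- probability measure; otherwise the common marginal determines the law.
  · rcases h1 with rfl | h1
    · simp [Measure.map_const]
    · have : (fun p : E d × E d => u p.1 - u' p.1) = (fun x => u x - u' x) ∘ Prod.fst := rfl
      rw [this, ← Measure.map_map (by fun_prop) measurable_fst,
        ← Measure.map_map (by fun_prop) measurable_fst]
      exact congrArg _ h1
  · rcases h2 with rfl | h2
    · simp [Measure.map_const]
    · have : (fun p : E d × E d => v p.2 - v' p.2) = (fun x => v x - v' x) ∘ Prod.snd := rfl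
      rw [this, ← Measure.map_map (by fun_prop) measurable_snd,
        ← Measure.map_map (by fun_prop) measurable_snd]
      exact congrArg _ h2

end

/-! ### Finiteness of exponential integrals at every point -/

section Finiteness

variable {W : E d → E d → ℝ} {A B u v : E d → ℝ} {T : E d →L[ℝ] E d}

lemma IsBilinearPotential.exp_eq (h : IsBilinearPotential W B A T) (x y : E d) (c : ℝ) :
    Real.exp (-(W x y + c)) = Real.exp (-B x) *
      (Real.exp (-(A y + c)) * Real.exp (inner ℝ (T x) y)) := by
  rw [h.eq, ← Real.exp_add, ← Real.exp_add]
  ring_nf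

lemma IsBilinearPotential.integrable_iff (h : IsBilinearPotential W B A T) (x : E d) :
    Integrable (fun y => Real.exp (-v y)) (gibbsKernel W x) ↔
      Integrable fun y => Real.exp (-(A y + v y)) * Real.exp (inner ℝ (T x) y) := by
  rw [integrable_gibbsKernel_iff h.measurable]
  simp_rw [h.exp_eq]
  exact integrable_const_mul_iff (Real.exp_pos _).ne'.isUnit _

/-- The set of points where an exponential integral is finite is convex, so that it is the whole
space as soon as its complement is negligible. -/
lemma IsBilinearPotential.integrable_of_ae (h : IsBilinearPotential W B A T) (hv : Measurable v)
    (hae : ∀ᵐ x, Integrable (fun y => Real.exp (-v y)) (gibbsKernel W x)) (x : E d) :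
    Integrable (fun y => Real.exp (-v y)) (gibbsKernel W x) := by
  -- The reflection `z ↦ 2x - z` preserves Lebesgue measure, so some `z` and its reflection are both
  -- good points; `x` is their midpoint, and the exponential of a mean is at most the sum of the
  -- exponentials.
  have hmp := Measure.measurePreserving_sub_left (volume : Measure (E d)) ((2 : ℝ) • x)
  obtain ⟨z, h1, h2⟩ := (hae.and (hmp.quasiMeasurePreserving.ae hae)).exists
  rw [h.integrable_iff] at h1 h2 ⊢
  have hA := h.measurable_right
  refine (h1.add h2).mono' (by fun_prop) (ae_of_all _ fun y => ?_)
  have hsum : inner ℝ (T x) y = (inner ℝ (T z) y + inner ℝ (T ((2 : ℝ) • x - z)) y) / 2 := by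
    rw [map_sub, map_smul, inner_sub_left, real_inner_smul_left]; ring
  rw [Real.norm_of_nonneg (by positivity), Pi.add_apply, ← mul_add]
  refine mul_le_mul_of_nonneg_left ?_ (Real.exp_pos _).le
  rcases le_total (inner ℝ (T z) y) (inner ℝ (T ((2 : ℝ) • x - z)) y) with h3 | h3
  · exact (Real.exp_le_exp.2 (by linarith)).trans (le_add_of_nonneg_left (Real.exp_pos _).le)
  · exact (Real.exp_le_exp.2 (by linarith)).trans (le_add_of_nonneg_right (Real.exp_pos _).le)

/-- Tonelli applied to the total mass 1 gives the claim for almost every `x`, and convexity extends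
it to all `x`. -/
lemma IsBilinearPotential.integrable_right (h : IsBilinearPotential W B A T) (hu : Measurable u)
    (hv : Measurable v) (hp : IsProbabilityMeasure (jointMeasure u v W)) (x : E d) :
    Integrable (fun y => Real.exp (-v y)) (gibbsKernel W x) := by
  refine h.integrable_of_ae hv ?_ x
  have hW' : Measurable fun p : E d × E d => W p.1 p.2 := h.measurable
  have hm : Measurable fun p : E d × E d =>
    ENNReal.ofReal (Real.exp (-(u p.1 + W p.1 p.2 + v p.2))) := by fun_prop
  have h1 := hp.measure_univ
  rw [jointMeasure, withDensity_apply _ MeasurableSet.univ, setLIntegral_univ,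
    lintegral_prod _ hm.aemeasurable] at h1
  filter_upwards [ae_lt_top hm.lintegral_prod_right' (h1.trans_ne ENNReal.one_ne_top)] with x hx
  rw [integrable_gibbsKernel_iff h.measurable]
  have hWx : Measurable (W x) := h.measurable.of_uncurry_left
  have h2 : Integrable fun y => Real.exp (-(u x + W x y + v y)) := by
    refine ⟨by fun_prop, ?_⟩
    rwa [hasFiniteIntegral_iff_ofReal (ae_of_all _ fun y => (Real.exp_pos _).le)]
  refine (h2.const_mul (Real.exp (u x))).congr (ae_of_all _ fun y => ?_)
  simp only
  rw [← Real.exp_add]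
  ring_nf

lemma IsBilinearPotential.integrable_left (h : IsBilinearPotential W B A T) (hu : Measurable u)
    (hv : Measurable v) (hp : IsProbabilityMeasure (jointMeasure u v W)) (y : E d) :
    Integrable (fun x => Real.exp (-u x)) (gibbsKernel (conj W) y) := by
  refine h.conjugate.integrable_right hv hu ?_ y
  rw [← jointMeasure_map_swap hu hv h.measurable]
  exact Measure.isProbabilityMeasure_map measurable_swap.aemeasurable

end Finiteness

/-! ### Sinkhorn bridges as Gibbs couplings -/

section Sinkhorn

variable {U V u v : E d → ℝ} {W : E d → E d → ℝ} {A B : E d → ℝ} {T : E d →L[ℝ] E d}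

/-- In a Sinkhorn half-step the new density relative to the old coupling depends on one coordinate
only, so only one potential moves. The integral defining it is finite because the old coupling has
mass 1. -/
lemma IsEntropicProjection.eq_of_firstMarginal (h : IsBilinearPotential W B A T)
    (hU : Measurable U) (hμ : IsProbabilityMeasure (gibbsMeasure U)) (hu : Measurable u)
    (hv : Measurable v) (hp : IsProbabilityMeasure (jointMeasure u v W))
    {Q : Measure (E d × E d)}
    (hQ : IsEntropicProjection (firstMarginal (gibbsMeasure U)) (jointMeasure u v W) Q) :
    Q = jointMeasure (potentialStep U W v) v W := by
  have hmem := jointMeasure_mem_firstMarginal hU hv h.measurable hμ (h.integrable_right hu hv hp) rfl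
  exact hQ.eq_jointMeasure hu hv (measurable_potentialStep hU hv) hv h.measurable hp hQ.1.1 hmem
    hmem.1 (Or.inr (hQ.1.2.trans hmem.2.symm)) (Or.inl rfl)

lemma IsEntropicProjection.eq_of_secondMarginal (h : IsBilinearPotential W B A T)
    (hV : Measurable V) (hη : IsProbabilityMeasure (gibbsMeasure V)) (hu : Measurable u)
    (hv : Measurable v) (hp : IsProbabilityMeasure (jointMeasure u v W))
    {Q : Measure (E d × E d)}
    (hQ : IsEntropicProjection (secondMarginal (gibbsMeasure V)) (jointMeasure u v W) Q) :
    Q = jointMeasure u (potentialStep V (conj W) u) W := by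
  have hmem := jointMeasure_mem_secondMarginal hV hu h.measurable hη (h.integrable_left hu hv hp) rfl
  exact hQ.eq_jointMeasure hu hv hu (measurable_potentialStep hV hu) h.measurable hp hQ.1.1 hmem
    hmem.1 (Or.inl rfl) (Or.inr (hQ.1.2.trans hmem.2.symm))

lemma sinkhornU_odd (U V : E d → ℝ) (W : E d → E d → ℝ) (n : ℕ) :
    sinkhornU U V W (2 * n + 1) = sinkhornU U V W (2 * n) := by
  simp [sinkhornU, sinkhornPotentials]

lemma sinkhornV_odd (U V : E d → ℝ) (W : E d → E d → ℝ) (n : ℕ) :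
    sinkhornV U V W (2 * n + 1) = potentialStep V (conj W) (sinkhornU U V W (2 * n + 1)) := by
  rw [sinkhornU_odd]
  simp [sinkhornV, sinkhornU, sinkhornPotentials]

lemma sinkhornU_even (U V : E d → ℝ) (W : E d → E d → ℝ) (n : ℕ) :
    sinkhornU U V W (2 * (n + 1)) = potentialStep U W (sinkhornV U V W (2 * n + 1)) := by
  have : ¬ Even (2 * n + 1) := Nat.not_even_iff_odd.2 (odd_two_mul_add_one n)
  rw [mul_add, mul_one, sinkhornU, sinkhornPotentials, if_neg this]
  rfl

lemma sinkhornV_even (U V : E d → ℝ) (W : E d → E d → ℝ) (n : ℕ) :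
    sinkhornV U V W (2 * (n + 1)) = sinkhornV U V W (2 * n + 1) := by
  have : ¬ Even (2 * n + 1) := Nat.not_even_iff_odd.2 (odd_two_mul_add_one n)
  rw [mul_add, mul_one, sinkhornV, sinkhornPotentials, if_neg this]
  rfl

/-- The Sinkhorn bridges of even index are the Gibbs measures of the Sinkhorn potentials. -/
lemma IsSinkhornSequence.eq_jointMeasure_even (h : IsBilinearPotential W B A T)
    (hU : Measurable U) (hV : Measurable V) (hμ : IsProbabilityMeasure (gibbsMeasure U))
    (hη : IsProbabilityMeasure (gibbsMeasure V)) [IsMarkovKernel (gibbsKernel W)]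
    {P : ℕ → Measure (E d × E d)}
    (hP : IsSinkhornSequence (gibbsMeasure U) (gibbsMeasure V) (referenceMeasure U W) P) (n : ℕ) :
    Measurable (sinkhornU U V W (2 * n)) ∧ Measurable (sinkhornV U V W (2 * n)) ∧
      IsProbabilityMeasure (P (2 * n)) ∧
      P (2 * n) = jointMeasure (sinkhornU U V W (2 * n)) (sinkhornV U V W (2 * n)) W := by
  induction n with
  | zero =>
    -- `K_W` is Markov, so `log K_W(1) = 0`.
    have h0 : sinkhornU U V W 0 = U := by
      ext x
      simp [sinkhornU, sinkhornPotentials, potentialStep]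
    have h0' : sinkhornV U V W 0 = 0 := rfl
    rw [mul_zero, h0, h0', hP.zero, referenceMeasure,
      gibbsMeasure_compProd_gibbsKernel hU h.measurable]
    refine ⟨hU, measurable_const, ?_, rfl⟩
    rw [← gibbsMeasure_compProd_gibbsKernel hU h.measurable]
    infer_instance
  | succ n ih =>
    obtain ⟨hu, hv, hp, he⟩ := ih
    have hodd := hP.odd n
    rw [he] at hodd hp
    have heq := hodd.eq_of_secondMarginal h hV hη hu hv hp
    have hp1 := hodd.1.1
    rw [← sinkhornU_odd, ← sinkhornV_odd] at heq
    rw [← sinkhornU_odd] at hu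
    have hv1 : Measurable (sinkhornV U V W (2 * n + 1)) := by
      rw [sinkhornV_odd]; exact measurable_potentialStep hV hu
    have heven := hP.even n
    rw [heq] at heven hp1
    have heq' := heven.eq_of_firstMarginal h hU hμ hu hv1 hp1
    rw [sinkhornU_even, sinkhornV_even]
    exact ⟨measurable_potentialStep hU hv1, hv1, heven.1.1, heq'⟩

end Sinkhorn

/-! ### The Gaussian density and its potential -/

lemma toEuclideanCLM_adjoint (M : Matrix (Fin d) (Fin d) ℝ) :
    (Matrix.toEuclideanCLM (𝕜 := ℝ) M).adjoint = Matrix.toEuclideanCLM (𝕜 := ℝ) Mᵀ := by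
  rw [← ContinuousLinearMap.star_eq_adjoint, ← map_star, Matrix.star_eq_conjTranspose,
    Matrix.conjTranspose_eq_transpose_of_trivial]

lemma toEuclideanCLM_mul_apply (M N : Matrix (Fin d) (Fin d) ℝ) (x : E d) :
    Matrix.toEuclideanCLM (𝕜 := ℝ) (M * N) x =
      Matrix.toEuclideanCLM (𝕜 := ℝ) M (Matrix.toEuclideanCLM (𝕜 := ℝ) N x) := by
  rw [map_mul]; rfl

lemma gaussianDensity_pos {τ : Matrix (Fin d) (Fin d) ℝ} (hτ : τ.PosDef) (z : E d) :
    0 < gaussianDensity τ z := by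
  have := hτ.det_pos
  unfold gaussianDensity
  positivity

lemma exp_neg_gaussianPotential {τ : Matrix (Fin d) (Fin d) ℝ} (hτ : τ.PosDef) (α : E d)
    (β : Matrix (Fin d) (Fin d) ℝ) (x y : E d) :
    Real.exp (-gaussianPotential α β τ x y) =
      gaussianDensity τ (y - (α + Matrix.toEuclideanCLM (𝕜 := ℝ) β x)) := by
  rw [gaussianPotential, neg_neg, Real.exp_log (gaussianDensity_pos hτ _)]

lemma continuous_gaussianDensity (τ : Matrix (Fin d) (Fin d) ℝ) :
    Continuous (gaussianDensity τ) := by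
  unfold gaussianDensity
  fun_prop

/-- The standard Gaussian integral in `ℝ^d`. -/
lemma integral_exp_neg_norm_sq_div_two :
    ∫ z : E d, Real.exp (-‖z‖ ^ 2 / 2) = √((2 * Real.pi) ^ d) := by
  have := GaussianFourier.integral_rexp_neg_mul_sq_norm (V := E d) (b := 1 / 2) (by norm_num)
  simp only [finrank_euclideanSpace, Fintype.card_fin] at this
  rw [Real.sqrt_eq_rpow, ← Real.rpow_natCast, ← Real.rpow_mul (by positivity)]
  have h1 : Real.pi / (1 / 2) = 2 * Real.pi := by ring
  have h2 : (d : ℝ) * (1 / 2) = d / 2 := by ring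
  rw [h1] at this
  rw [h2, ← this]
  refine integral_congr_ae (ae_of_all _ fun z => ?_)
  simp only
  congr 1
  ring

lemma integrable_exp_neg_norm_sq_div_two :
    Integrable fun z : E d => Real.exp (-‖z‖ ^ 2 / 2) := by
  -- A non-integrable function has integral 0 by convention, but the computed value is positive.
  by_contra h
  have := integral_exp_neg_norm_sq_div_two (d := d)
  rw [integral_undef h] at this
  have h2 : 0 < √((2 * Real.pi) ^ d) := by positivity
  exact h2.ne this

open scoped MatrixOrder Matrix.Norms.L2Operator in
lemma exists_eq_transpose_mul_self {M : Matrix (Fin d) (Fin d) ℝ} (hM : M.PosSemidef) :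
    ∃ N : Matrix (Fin d) (Fin d) ℝ, M = Nᵀ * N := by
  obtain ⟨N, hN⟩ := CStarAlgebra.nonneg_iff_eq_star_mul_self.mp hM.nonneg
  exact ⟨N, by rw [hN, Matrix.star_eq_conjTranspose,
    Matrix.conjTranspose_eq_transpose_of_trivial]⟩

/-- With `τ = M'M`, the substitution `z = M'w` turns the quadratic form into `‖w‖²`, and its
Jacobian `|det M| = √(det τ)` cancels the normalising factor. -/
lemma lintegral_gaussianDensity {τ : Matrix (Fin d) (Fin d) ℝ} (hτ : τ.PosDef) :
    ∫⁻ z, ENNReal.ofReal (gaussianDensity τ z) = 1 := by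
  obtain ⟨M, hM⟩ : ∃ M : Matrix (Fin d) (Fin d) ℝ, τ = Mᵀ * M :=
    exists_eq_transpose_mul_self hτ.posSemidef
  have hdet : τ.det = M.det ^ 2 := by rw [hM, Matrix.det_mul, Matrix.det_transpose, sq]
  have hMdet : M.det ≠ 0 := fun h0 => hτ.det_pos.ne' (by rw [hdet, h0]; simp)
  set L := Matrix.toEuclideanCLM (𝕜 := ℝ) Mᵀ with hL
  have hLdet : LinearMap.det (L : E d →ₗ[ℝ] E d) = M.det := by
    rw [hL, Matrix.coe_toEuclideanCLM_eq_toEuclideanLin, ← Matrix.det_transpose]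
    exact LinearMap.det_toLpLin 2 Mᵀ
  have hquad : ∀ w, gaussianDensity τ (L w) = (√((2 * Real.pi) ^ d * τ.det))⁻¹ *
      Real.exp (-‖w‖ ^ 2 / 2) := fun w => by
    rw [gaussianDensity]
    congr 3
    rw [hL, ← toEuclideanCLM_adjoint, ContinuousLinearMap.adjoint_inner_left, toEuclideanCLM_adjoint,
      ← toEuclideanCLM_mul_apply, ← toEuclideanCLM_mul_apply]
    have : M * τ⁻¹ * Mᵀ = 1 := by
      rw [hM, Matrix.mul_inv_rev, Matrix.mul_assoc, Matrix.mul_assoc, Matrix.nonsing_inv_mul _ (by simpa using hMdet),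
        Matrix.mul_one, Matrix.mul_nonsing_inv _ (by simpa using hMdet)]
    rw [this, map_one, one_apply_eq_self, real_inner_self_eq_norm_sq]
  have hmap := Measure.map_linearMap_addHaar_eq_smul_addHaar (volume : Measure (E d))
    (f := (L : E d →ₗ[ℝ] E d)) (by rwa [hLdet])
  rw [hLdet] at hmap
  have h1 : ∫⁻ z, ENNReal.ofReal (gaussianDensity τ z) ∂(Measure.map L volume)
      = ENNReal.ofReal |M.det⁻¹| * ∫⁻ z, ENNReal.ofReal (gaussianDensity τ z) := by
    have : Measure.map L volume = ENNReal.ofReal |M.det⁻¹| • (volume : Measure (E d)) := hmap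
    rw [this, lintegral_smul_measure, smul_eq_mul]
  rw [lintegral_map (continuous_gaussianDensity τ).measurable.ennreal_ofReal
    L.continuous.measurable] at h1
  simp_rw [hquad] at h1
  rw [← ofReal_integral_eq_lintegral_ofReal (integrable_exp_neg_norm_sq_div_two.const_mul _)
    (ae_of_all _ fun y => by positivity), integral_const_mul, integral_exp_neg_norm_sq_div_two,
    hdet, Real.sqrt_mul (by positivity), Real.sqrt_sq_eq_abs] at h1
  have h2 : (√((2 * Real.pi) ^ d) * |M.det|)⁻¹ * √((2 * Real.pi) ^ d) = |M.det⁻¹| := by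
    rw [abs_inv]
    have : √((2 * Real.pi) ^ d) ≠ 0 := by positivity
    field_simp
  rw [h2] at h1
  have h3 : ENNReal.ofReal |M.det⁻¹| ≠ 0 := by
    simpa using hMdet
  exact ((ENNReal.mul_eq_left h3 ENNReal.ofReal_ne_top).1 h1.symm)

/-- The quadratic potential in the second variable. -/
noncomputable def quadraticPotential (α : E d) (τ : Matrix (Fin d) (Fin d) ℝ) (y : E d) : ℝ :=
  inner ℝ (y - α) (Matrix.toEuclideanCLM (𝕜 := ℝ) τ⁻¹ (y - α)) / 2

/-- Expand the square around `y - α`: the cross term yields `-⟨τ⁻¹βx, y⟩` and a function of `x`,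
which joins `B` with the normalising constant. `B` stays existential because only its measurability
is used. -/
lemma isBilinearPotential_gaussianPotential {τ : Matrix (Fin d) (Fin d) ℝ} (hτ : τ.PosDef)
    (α : E d) (β : Matrix (Fin d) (Fin d) ℝ) :
    ∃ B : E d → ℝ, IsBilinearPotential (gaussianPotential α β τ) B (quadraticPotential α τ)
      (Matrix.toEuclideanCLM (𝕜 := ℝ) (τ⁻¹ * β)) := by
  set S := Matrix.toEuclideanCLM (𝕜 := ℝ) τ⁻¹ with hS
  set T := Matrix.toEuclideanCLM (𝕜 := ℝ) β with hT
  have hsymm : ∀ x y, inner ℝ (S x) y = inner ℝ x (S y) := fun x y => by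
    rw [← ContinuousLinearMap.adjoint_inner_right, hS, toEuclideanCLM_adjoint]
    rw [Matrix.transpose_nonsing_inv]
    have := hτ.isHermitian
    rw [Matrix.IsHermitian, Matrix.conjTranspose_eq_transpose_of_trivial] at this
    rw [this]
  refine ⟨fun x => inner ℝ (T x) (S (T x)) / 2 + inner ℝ (S (T x)) α
    - Real.log (√((2 * Real.pi) ^ d * τ.det))⁻¹, ?_, ?_, fun x y => ?_⟩
  · fun_prop
  · unfold quadraticPotential
    fun_prop
  · have hc : (√((2 * Real.pi) ^ d * τ.det))⁻¹ ≠ 0 := by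
      have := hτ.det_pos
      positivity
    rw [gaussianPotential, gaussianDensity, Real.log_mul hc (Real.exp_pos _).ne', Real.log_exp,
      quadraticPotential, toEuclideanCLM_mul_apply, ← hS, ← hT]
    have h1 : y - (α + T x) = (y - α) - T x := by abel
    have h2 := hsymm (T x) (y - α)
    have h3 : inner ℝ (y - α) (S (T x)) = inner ℝ (S (T x)) (y - α) := real_inner_comm _ _
    rw [h1, map_sub, inner_sub_left, inner_sub_right, inner_sub_right, ← h2, h3,
      inner_sub_right (S (T x))]
    ring

lemma isMarkovKernel_gaussian {τ : Matrix (Fin d) (Fin d) ℝ} (hτ : τ.PosDef) (α : E d)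
    (β : Matrix (Fin d) (Fin d) ℝ) : IsMarkovKernel (gibbsKernel (gaussianPotential α β τ)) := by
  obtain ⟨B, hB⟩ := isBilinearPotential_gaussianPotential hτ α β
  refine ⟨fun x => ⟨?_⟩⟩
  rw [gibbsKernel_apply hB.measurable, withDensity_apply _ MeasurableSet.univ, setLIntegral_univ]
  simp_rw [exp_neg_gaussianPotential hτ]
  rw [lintegral_sub_right_eq_self (fun z => ENNReal.ofReal (gaussianDensity τ z))]
  exact lintegral_gaussianDensity hτ

/-! ### Exponential moments and differentiation of Laplace transforms -/

lemma norm_le_sum_abs (x : E d) : ‖x‖ ≤ ∑ i, |x i| := by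
  have h := (EuclideanSpace.basisFun (Fin d) ℝ).sum_repr x
  calc ‖x‖ = ‖∑ i, (EuclideanSpace.basisFun (Fin d) ℝ).repr x i •
        EuclideanSpace.basisFun (Fin d) ℝ i‖ := by rw [h]
    _ ≤ ∑ i, ‖(EuclideanSpace.basisFun (Fin d) ℝ).repr x i •
        EuclideanSpace.basisFun (Fin d) ℝ i‖ := norm_sum_le _ _
    _ = ∑ i, |x i| := by simp [norm_smul]

/-- Some coordinate satisfies `‖x‖ ≤ d |x i|`, so finitely many exponentials of linear forms
dominate; the 1 covers `x = 0`, in particular `d = 0`. A Laplace transform finite everywhere thus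
gives all exponential moments of the norm. -/
lemma exp_mul_norm_le (c : ℝ) (hc : 0 ≤ c) (x : E d) :
    Real.exp (c * ‖x‖) ≤ 1 + ∑ i, (Real.exp (inner ℝ (EuclideanSpace.single i (c * d)) x) +
      Real.exp (inner ℝ (EuclideanSpace.single i (-(c * d))) x)) := by
  by_cases hx : x = 0
  · subst hx
    simp only [norm_zero, mul_zero, Real.exp_zero]
    exact le_add_of_nonneg_right (Finset.sum_nonneg fun i _ => by positivity)
  obtain ⟨i, hi⟩ : ∃ i, ‖x‖ ≤ d * |x i| := by
    by_contra! h
    have h1 := norm_le_sum_abs x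
    have hne : (Finset.univ : Finset (Fin d)).Nonempty := by
      rw [Finset.univ_nonempty_iff]
      by_contra h0
      rw [not_nonempty_iff] at h0
      exact hx (Subsingleton.elim _ _)
    have h2 : ∑ i, d * |x i| < ∑ _i : Fin d, ‖x‖ := Finset.sum_lt_sum_of_nonempty hne fun i _ => h i
    rw [← Finset.mul_sum, Finset.sum_const, Finset.card_univ, Fintype.card_fin,
      nsmul_eq_mul] at h2
    have : (0 : ℝ) ≤ d := d.cast_nonneg
    nlinarith
  have hle : Real.exp (c * ‖x‖) ≤ Real.exp (inner ℝ (EuclideanSpace.single i (c * d)) x) +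
      Real.exp (inner ℝ (EuclideanSpace.single i (-(c * d))) x) := by
    simp only [EuclideanSpace.inner_single_left, conj_trivial]
    have h3 := mul_le_mul_of_nonneg_left hi hc
    rcases abs_cases (x i) with ⟨h4, -⟩ | ⟨h4, -⟩
    · rw [h4] at h3
      exact (Real.exp_le_exp.2 (by linarith)).trans (le_add_of_nonneg_right (Real.exp_pos _).le)
    · rw [h4] at h3
      exact (Real.exp_le_exp.2 (by linarith)).trans (le_add_of_nonneg_left (Real.exp_pos _).le)
  refine hle.trans ?_
  refine (Finset.single_le_sum (f := fun i =>
    Real.exp (inner ℝ (EuclideanSpace.single i (c * d)) x) +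
      Real.exp (inner ℝ (EuclideanSpace.single i (-(c * d))) x))
    (fun i _ => by positivity) (Finset.mem_univ i)).trans ?_
  exact le_add_of_nonneg_left zero_le_one

section Laplace

variable {ρ : Measure (E d)} (hρ : ∀ w : E d, Integrable (fun x => Real.exp (inner ℝ w x)) ρ)
include hρ

lemma integrable_exp_mul_norm (c : ℝ) : Integrable (fun x => Real.exp (c * ‖x‖)) ρ := by
  have h1 : Integrable (fun _ => (1 : ℝ)) ρ := by simpa using hρ 0
  have h2 : Integrable (fun x => 1 + ∑ i,
      (Real.exp (inner ℝ (EuclideanSpace.single i (|c| * d)) x) +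
      Real.exp (inner ℝ (EuclideanSpace.single i (-(|c| * d))) x))) ρ :=
    h1.add (integrable_finsetSum _ fun i _ => (hρ _).add (hρ _))
  refine h2.mono' (by fun_prop) (ae_of_all _ fun x => ?_)
  rw [Real.norm_of_nonneg (Real.exp_pos _).le]
  refine le_trans (Real.exp_le_exp.2 ?_) (exp_mul_norm_le |c| (abs_nonneg c) x)
  exact mul_le_mul_of_nonneg_right (le_abs_self c) (norm_nonneg x)

variable {F : Type*} [NormedAddCommGroup F] [NormedSpace ℝ F]

lemma integrable_exp_inner_smul {f : E d → F} (hf : Continuous f) [SecondCountableTopology F]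
    {k : ℝ} (hk : ∀ x, ‖f x‖ ≤ Real.exp (k * ‖x‖)) (w : E d) :
    Integrable (fun x => Real.exp (inner ℝ w x) • f x) ρ := by
  refine (integrable_exp_mul_norm hρ (‖w‖ + k)).mono' (by fun_prop) (ae_of_all _ fun x => ?_)
  rw [norm_smul, Real.norm_of_nonneg (Real.exp_pos _).le, add_mul, Real.exp_add]
  exact mul_le_mul (Real.exp_le_exp.2 (real_inner_le_norm w x)) (hk x) (norm_nonneg _)
    (Real.exp_pos _).le

/-- Differentiation of a Laplace transform under the integral sign. -/
lemma hasFDerivAt_integral_exp_inner_smul {f : E d → F} (hf : Continuous f)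
    [SecondCountableTopology F] {k : ℝ} (hk : ∀ x, ‖f x‖ ≤ Real.exp (k * ‖x‖)) (w : E d) :
    HasFDerivAt (fun w => ∫ x, Real.exp (inner ℝ w x) • f x ∂ρ)
      (∫ x, Real.exp (inner ℝ w x) • (innerSL ℝ x).smulRight (f x) ∂ρ) w := by
  have hcont : Continuous fun x : E d => (innerSL ℝ x).smulRight (f x) := by
    have : (fun x : E d => (innerSL ℝ x).smulRight (f x)) =
        fun x => ContinuousLinearMap.smulRightL ℝ (E d) F (innerSL ℝ x) (f x) := rfl
    rw [this]
    fun_prop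
  have hcont' : Continuous fun x : E d => Real.exp (inner ℝ w x) • (innerSL ℝ x).smulRight (f x) :=
    (by fun_prop : Continuous fun x : E d => Real.exp (inner ℝ w x)).smul hcont
  refine hasFDerivAt_integral_of_dominated_of_fderiv_le
    (F' := fun w x => Real.exp (inner ℝ w x) • (innerSL ℝ x).smulRight (f x))
    -- In the 2, one unit comes from `‖v‖ ≤ ‖w‖ + 1` on the unit ball, the other from `‖x‖ ≤
    -- e^{‖x‖}` for the factor brought down by the derivative.
    (bound := fun x => Real.exp ((‖w‖ + 2 + k) * ‖x‖)) (Metric.ball_mem_nhds w one_pos)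
    (Filter.Eventually.of_forall fun v => (integrable_exp_inner_smul hρ hf hk v).1)
    (integrable_exp_inner_smul hρ hf hk w)
    (hcont'.aestronglyMeasurable) (ae_of_all _ fun x v hv => ?_)
    (integrable_exp_mul_norm hρ _) (ae_of_all _ fun x v _ => ?_)
  · rw [norm_smul, Real.norm_of_nonneg (Real.exp_pos _).le, ContinuousLinearMap.norm_smulRight_apply,
      innerSL_apply_norm]
    have hv' : ‖v‖ ≤ ‖w‖ + 1 := by
      have := norm_le_norm_add_norm_sub' v w
      rw [mem_ball_iff_norm] at hv
      linarith
    have h1 : Real.exp (inner ℝ v x) ≤ Real.exp ((‖w‖ + 1) * ‖x‖) :=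
      Real.exp_le_exp.2 ((real_inner_le_norm v x).trans
        (mul_le_mul_of_nonneg_right hv' (norm_nonneg x)))
    have h2 : ‖x‖ ≤ Real.exp ‖x‖ := by linarith [Real.add_one_le_exp ‖x‖]
    calc Real.exp (inner ℝ v x) * (‖x‖ * ‖f x‖)
        ≤ Real.exp ((‖w‖ + 1) * ‖x‖) * (Real.exp ‖x‖ * Real.exp (k * ‖x‖)) := by
          gcongr
          exact hk x
      _ = Real.exp ((‖w‖ + 2 + k) * ‖x‖) := by
          rw [← Real.exp_add, ← Real.exp_add]; ring_nf
  · have h1 : HasFDerivAt (fun v : E d => inner ℝ v x) (innerSL ℝ x) v := by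
      have := (innerSL ℝ x).hasFDerivAt (x := v)
      refine this.congr_of_eventuallyEq (Filter.Eventually.of_forall fun v => ?_)
      simp [real_inner_comm]
    have h2 := (h1.exp).smul_const (f x)
    convert h2 using 1
    ext z
    simp [smul_smul]

end Laplace

/-! ### Mean and covariance of exponentially tilted measures -/

/-- The matrix of a linear map is determined by the images of the standard basis. -/
lemma eq_toEuclideanCLM {C : E d →L[ℝ] E d} {M : Matrix (Fin d) (Fin d) ℝ}
    (h : ∀ i j, C (EuclideanSpace.single j 1) i = M i j) :
    C = Matrix.toEuclideanCLM (𝕜 := ℝ) M := by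
  have : (C : E d →ₗ[ℝ] E d) = (Matrix.toEuclideanCLM (𝕜 := ℝ) M : E d →ₗ[ℝ] E d) := by
    refine (EuclideanSpace.basisFun (Fin d) ℝ).toBasis.ext fun j => ?_
    ext i
    simp [h]
  exact ContinuousLinearMap.coe_injective this

lemma toEuclideanCLM_single (M : Matrix (Fin d) (Fin d) ℝ) (i j : Fin d) :
    Matrix.toEuclideanCLM (𝕜 := ℝ) M (EuclideanSpace.single j 1) i = M i j := by
  simp

/-- The mean of the exponentially tilted measure `e^{⟨w, x⟩} ρ(dx) / ∫ e^{⟨w, x⟩} ρ(dx)`. -/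
noncomputable def tiltMean (ρ : Measure (E d)) (w : E d) : E d :=
  ∫ x, x ∂(ρ.tilted fun x => inner ℝ w x)

/-- The covariance of the exponentially tilted measure. -/
noncomputable def tiltCov (ρ : Measure (E d)) (w : E d) : Matrix (Fin d) (Fin d) ℝ :=
  Matrix.of fun i j => ∫ x, (x i - tiltMean ρ w i) * (x j - tiltMean ρ w j)
    ∂(ρ.tilted fun x => inner ℝ w x)

section Tilt

variable {ρ : Measure (E d)} (hρ : ∀ w : E d, Integrable (fun x => Real.exp (inner ℝ w x)) ρ)
include hρ

lemma memLp_id_tilted (w : E d) : MemLp id 2 (ρ.tilted fun x => inner ℝ w x) := by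
  rw [memLp_two_iff_integrable_sq_norm aestronglyMeasurable_id, integrable_tilted_iff (hρ w)]
  refine integrable_exp_inner_smul hρ (k := 2) (by fun_prop) (fun x => ?_) w
  have h2 : ‖x‖ ≤ Real.exp ‖x‖ := by linarith [Real.add_one_le_exp ‖x‖]
  rw [norm_pow, id_eq, norm_norm, two_mul, Real.exp_add, sq]
  gcongr

omit hρ in
lemma tiltMean_eq (w : E d) : tiltMean ρ w = (∫ x, Real.exp (inner ℝ w x) ∂ρ)⁻¹ •
    ∫ x, Real.exp (inner ℝ w x) • x ∂ρ := by
  rw [tiltMean, integral_tilted, ← integral_smul]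
  simp_rw [smul_smul, div_eq_inv_mul]

variable (hne : ρ ≠ 0)
include hne

lemma integral_exp_inner_pos (w : E d) : 0 < ∫ x, Real.exp (inner ℝ w x) ∂ρ :=
  have : NeZero ρ := ⟨hne⟩
  integral_exp_pos (hρ w)

omit hne in
lemma hasFDerivAt_integral_exp_inner (w : E d) :
    HasFDerivAt (fun w => ∫ x, Real.exp (inner ℝ w x) ∂ρ)
      (innerSL ℝ (∫ x, Real.exp (inner ℝ w x) • x ∂ρ)) w := by
  have h := hasFDerivAt_integral_exp_inner_smul hρ (f := fun _ => (1 : ℝ)) (k := 0)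
    continuous_const (by simp) w
  simp only [smul_eq_mul, mul_one] at h
  refine h.congr_fderiv ?_
  have hint : Integrable (fun x => Real.exp (inner ℝ w x) • x) ρ :=
    integrable_exp_inner_smul hρ (k := 1) continuous_id
      (fun x => by simp only [id_eq, one_mul]; linarith [Real.add_one_le_exp ‖x‖]) w
  rw [← ContinuousLinearMap.integral_comp_comm (innerSL ℝ) hint]
  refine integral_congr_ae (ae_of_all _ fun x => ?_)
  ext z
  simp
  rfl

/-- The gradient of the log-Laplace transform is the mean of the tilted measure. -/
lemma hasGradientAt_log_laplace (w : E d) :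
    HasGradientAt (fun w => Real.log (∫ x, Real.exp (inner ℝ w x) ∂ρ)) (tiltMean ρ w) w := by
  rw [hasGradientAt_iff_hasFDerivAt]
  have h := (hasFDerivAt_integral_exp_inner hρ w).log (integral_exp_inner_pos hρ hne w).ne'
  refine h.congr_fderiv ?_
  rw [tiltMean_eq]
  ext z
  simp

/-- The derivative of the mean of the tilted measure is its covariance. -/
lemma hasFDerivAt_tiltMean (w : E d) :
    HasFDerivAt (tiltMean ρ) (Matrix.toEuclideanCLM (𝕜 := ℝ) (tiltCov ρ w)) w := by
  have hZ := integral_exp_inner_pos hρ hne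
  have hle : ∀ x : E d, ‖id x‖ ≤ Real.exp (1 * ‖x‖) := fun x => by
    simp only [id_eq, one_mul]; linarith [Real.add_one_le_exp ‖x‖]
  -- The mean is `N / Z` with `∇Z = N`, so its derivative is `DN / Z - N ⊗ N / Z²`, with entries
  -- `E[x_i x_j] - m_i m_j`.
  have h1 := (hasDerivAt_inv (hZ w).ne').comp_hasFDerivAt w (hasFDerivAt_integral_exp_inner hρ w)
  have h2 := hasFDerivAt_integral_exp_inner_smul hρ continuous_id hle w
  have h3 := h1.smul h2
  have hfun : tiltMean ρ = fun w => (∫ x, Real.exp (inner ℝ w x) ∂ρ)⁻¹ •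
    ∫ x, Real.exp (inner ℝ w x) • id x ∂ρ := funext fun w => tiltMean_eq w
  rw [hfun]
  refine h3.congr_fderiv ?_
  apply eq_toEuclideanCLM
  intro i j
  have hp : IsProbabilityMeasure (ρ.tilted fun x => inner ℝ w x) :=
    have : NeZero ρ := ⟨hne⟩
    isProbabilityMeasure_tilted (hρ w)
  have hid := memLp_id_tilted hρ w
  have hmem : ∀ i : Fin d, MemLp (fun x : E d => x i) 2 (ρ.tilted fun x => inner ℝ w x) :=
    fun i => (EuclideanSpace.proj (𝕜 := ℝ) i).comp_memLp' hid
  have hmean : ∀ i : Fin d, ∫ x : E d, x i ∂(ρ.tilted fun x => inner ℝ w x) = tiltMean ρ w i :=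
    fun i => (EuclideanSpace.proj (𝕜 := ℝ) i).integral_comp_comm
      (hid.integrable one_le_two)
  have hcov : tiltCov ρ w i j =
      cov[fun x : E d => x i, fun x : E d => x j; ρ.tilted fun x => inner ℝ w x] := by
    rw [tiltCov, Matrix.of_apply, covariance, hmean, hmean]
  rw [hcov, covariance_eq_sub (hmem i) (hmem j), hmean, hmean, integral_tilted]
  have hD : ((∫ x, Real.exp (inner ℝ w x) • (innerSL ℝ x).smulRight (id x) ∂ρ)
      (EuclideanSpace.single j 1)) i = ∫ x, Real.exp (inner ℝ w x) * (x i * x j) ∂ρ := by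
    have hint : Integrable
        (fun x : E d => Real.exp (inner ℝ w x) • (innerSL ℝ x).smulRight (id x)) ρ := by
      refine integrable_exp_inner_smul hρ (k := 2) ?_ (fun x => ?_) w
      · exact ((ContinuousLinearMap.smulRightL ℝ (E d) (E d)).continuous.comp
          (innerSL ℝ).continuous).clm_apply continuous_id
      · rw [ContinuousLinearMap.norm_smulRight_apply, innerSL_apply_norm, two_mul, Real.exp_add,
          id_eq]
        have h2 : ‖x‖ ≤ Real.exp ‖x‖ := by linarith [Real.add_one_le_exp ‖x‖]
        gcongr
    rw [ContinuousLinearMap.integral_apply hint]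
    have := (EuclideanSpace.proj (𝕜 := ℝ) i).integral_comp_comm
      (hint.apply_continuousLinearMap (EuclideanSpace.single j (1 : ℝ)))
    refine this.symm.trans (integral_congr_ae (ae_of_all _ fun x => ?_))
    change Real.exp (inner ℝ w x) * (inner ℝ x (EuclideanSpace.single j 1) * x i) = _
    rw [EuclideanSpace.inner_single_right]
    simp [mul_comm]
  set N := ∫ x, Real.exp (inner ℝ w x) • x ∂ρ
  have hsplit : ∀ (a : ℝ) (D : E d →L[ℝ] E d) (b : ℝ),
      ((a • D + (b • innerSL ℝ N).smulRight N) (EuclideanSpace.single j 1)) i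
        = a * (D (EuclideanSpace.single j 1)) i + b * (N i * N j) := fun a D b => by
    change a * (D (EuclideanSpace.single j 1)) i +
      (b * inner ℝ N (EuclideanSpace.single j 1)) * N i = _
    rw [EuclideanSpace.inner_single_right]
    simp only [one_mul, conj_trivial]
    ring
  refine (hsplit _ _ _).trans ?_
  rw [hD, tiltMean_eq]
  simp only [Function.comp_apply, PiLp.smul_apply, smul_eq_mul, Pi.mul_apply]
  rw [← integral_const_mul]
  simp_rw [div_eq_inv_mul, mul_assoc]
  ring

end Tilt

/-! ### Backward transitions as tilted measures; derivatives of the potentials -/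

/-- The Gibbs measure `e^{-(B + u)}` from which the backward transitions are obtained by exponential
tilting. -/
noncomputable def tiltBase (B u : E d → ℝ) : Measure (E d) := gibbsMeasure fun x => B x + u x

section

variable {V A B u : E d → ℝ} {W : E d → E d → ℝ} {T : E d →L[ℝ] E d}
  {χ : Matrix (Fin d) (Fin d) ℝ}

lemma tiltBase_ne_zero (hB : Measurable B) (hu : Measurable u) : tiltBase B u ≠ 0 := by
  intro h
  rw [tiltBase, gibbsMeasure, withDensity_eq_zero_iff (by fun_prop)] at h
  obtain ⟨x, hx⟩ := h.exists
  have := Real.exp_pos (-(B x + u x))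
  simp only [Pi.zero_apply, ENNReal.ofReal_eq_zero] at hx
  linarith

lemma integrable_tiltBase_iff (hB : Measurable B) (hu : Measurable u) (w : E d) :
    Integrable (fun x => Real.exp (inner ℝ w x)) (tiltBase B u) ↔
      Integrable fun x => Real.exp (-(B x + u x)) * Real.exp (inner ℝ w x) := by
  rw [tiltBase, gibbsMeasure, integrable_withDensity_iff_integrable_smul' (by fun_prop) (by simp)]
  simp only [ENNReal.toReal_ofReal (Real.exp_pos _).le, smul_eq_mul]

lemma integral_tiltBase (hB : Measurable B) (hu : Measurable u) (w : E d) :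
    ∫ x, Real.exp (inner ℝ w x) ∂(tiltBase B u) =
      ∫ x, Real.exp (-(B x + u x)) * Real.exp (inner ℝ w x) := by
  rw [tiltBase, gibbsMeasure, integral_withDensity_eq_integral_toReal_smul (by fun_prop) (by simp)]
  simp only [ENNReal.toReal_ofReal (Real.exp_pos _).le, smul_eq_mul]

/-- Invertibility of `χ` enters here: every `w` is `χ'y` with `y = (χ')⁻¹w`, so finiteness at all
`y` is finiteness of the Laplace transform at all `w`. -/
lemma IsBilinearPotential.integrable_tiltBase
    (h : IsBilinearPotential W B A (Matrix.toEuclideanCLM (𝕜 := ℝ) χ)) (hχ : IsUnit χ.det)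
    (hu : Measurable u)
    (hint : ∀ y, Integrable (fun x => Real.exp (-u x)) (gibbsKernel (conj W) y)) (w : E d) :
    Integrable (fun x => Real.exp (inner ℝ w x)) (tiltBase B u) := by
  rw [integrable_tiltBase_iff h.measurable_left hu]
  have h1 := (h.conjugate.integrable_iff _).1 (hint (Matrix.toEuclideanCLM (𝕜 := ℝ) (χᵀ)⁻¹ w))
  rwa [toEuclideanCLM_adjoint, ← toEuclideanCLM_mul_apply,
    Matrix.mul_nonsing_inv _ (by simpa using hχ), map_one, one_apply_eq_self] at h1

lemma IsBilinearPotential.potentialStep_conj_eq (h : IsBilinearPotential W B A T)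
    (hu : Measurable u)
    (hint : ∀ y, Integrable (fun x => Real.exp (-u x)) (gibbsKernel (conj W) y)) (y : E d) :
    potentialStep V (conj W) u y = V y - A y +
      Real.log (∫ x, Real.exp (inner ℝ (T.adjoint y) x) ∂(tiltBase B u)) := by
  have h0 := (h.conjugate.integrable_iff _).1 (hint y)
  rw [potentialStep, integral_gibbsKernel h.conjugate.measurable]
  simp_rw [h.conjugate.exp_eq]
  have : ∫ x, Real.exp (-(B x + u x)) * Real.exp (inner ℝ (T.adjoint y) x) ≠ 0 := by
    simp_rw [← Real.exp_add] at h0 ⊢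
    exact (integral_exp_pos h0).ne'
  rw [integral_const_mul, Real.log_mul (Real.exp_pos _).ne' this, Real.log_exp,
    integral_tiltBase h.measurable_left hu]
  ring

/-- For fixed `y`, factors depending on `y` alone are absorbed by the normalisation, leaving
`e^{⟨T'y, x⟩}` against `e^{-(B+u)} dx`. -/
lemma IsBilinearPotential.normalizedKernel_conj_eq_tilted (h : IsBilinearPotential W B A T)
    (hV : Measurable V) (hu : Measurable u)
    (hint : ∀ y, Integrable (fun x => Real.exp (-u x)) (gibbsKernel (conj W) y)) (y : E d) :
    normalizedKernel V (potentialStep V (conj W) u) u (conj W) y =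
      (tiltBase B u).tilted fun x => inner ℝ (T.adjoint y) x := by
  have hB := h.measurable_left
  have hpos : 0 < ∫ x, Real.exp (inner ℝ (T.adjoint y) x) ∂(tiltBase B u) := by
    have : NeZero (tiltBase B u) := ⟨tiltBase_ne_zero hB hu⟩
    exact integral_exp_pos ((integrable_tiltBase_iff hB hu _).2
      ((h.conjugate.integrable_iff _).1 (hint y)))
  rw [normalizedKernel, gibbsKernel_apply (measurable_normalizedKernel hV
    (measurable_potentialStep hV hu) hu h.conjugate.measurable), Measure.tilted]
  conv_rhs => rw [tiltBase, gibbsMeasure]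
  rw [← withDensity_mul _ (by fun_prop) (by fun_prop)]
  congr 1
  ext x
  simp only [Pi.mul_apply]
  rw [← ENNReal.ofReal_mul (Real.exp_pos _).le, h.potentialStep_conj_eq hu hint]
  congr 1
  set Z := ∫ x, Real.exp (inner ℝ (T.adjoint y) x) ∂(tiltBase B u)
  have h1 : Real.exp (inner ℝ (T.adjoint y) x) / Z =
      Real.exp (inner ℝ (T.adjoint y) x - Real.log Z) := by
    rw [Real.exp_sub, Real.exp_log hpos]
  change _ = Real.exp (-(B x + u x)) * (Real.exp (inner ℝ (T.adjoint y) x) / Z)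
  rw [h1, ← Real.exp_add, h.conjugate.eq]
  congr 1
  ring

/-- The gradient of the potential `V + log K_{W^♭}(e^{-u})`, in terms of the conditional mean. -/
lemma IsBilinearPotential.hasGradientAt_potentialStep_conj
    (h : IsBilinearPotential W B A (Matrix.toEuclideanCLM (𝕜 := ℝ) χ)) (hχ : IsUnit χ.det)
    (hu : Measurable u)
    (hint : ∀ y, Integrable (fun x => Real.exp (-u x)) (gibbsKernel (conj W) y))
    (hV : TwiceDifferentiable V) (hA : TwiceDifferentiable A) (y : E d) :
    HasGradientAt (potentialStep V (conj W) u)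
      (gradient V y - gradient A y + Matrix.toEuclideanCLM (𝕜 := ℝ) χ
        (tiltMean (tiltBase B u) (Matrix.toEuclideanCLM (𝕜 := ℝ) χᵀ y))) y := by
  have hρ := h.integrable_tiltBase hχ hu hint
  have hne := tiltBase_ne_zero h.measurable_left hu
  have h1 := (hV.1 y).hasGradientAt.hasFDerivAt
  have h2 := (hA.1 y).hasGradientAt.hasFDerivAt
  have h3 := (hasGradientAt_log_laplace hρ hne
    (Matrix.toEuclideanCLM (𝕜 := ℝ) χᵀ y)).hasFDerivAt
  have h4 := h3.comp y (Matrix.toEuclideanCLM (𝕜 := ℝ) χᵀ).hasFDerivAt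
  rw [hasGradientAt_iff_hasFDerivAt]
  have hfun : potentialStep V (conj W) u = _ := funext (h.potentialStep_conj_eq hu hint)
  rw [hfun]
  simp_rw [toEuclideanCLM_adjoint]
  refine ((h1.sub h2).add h4).congr_fderiv ?_
  ext z
  simp only [add_apply, sub_apply,
    ContinuousLinearMap.comp_apply, InnerProductSpace.toDual_apply_apply, inner_add_left,
    inner_sub_left]
  rw [← toEuclideanCLM_adjoint, ContinuousLinearMap.adjoint_inner_right]

lemma IsBilinearPotential.gradient_potentialStep_conj
    (h : IsBilinearPotential W B A (Matrix.toEuclideanCLM (𝕜 := ℝ) χ)) (hχ : IsUnit χ.det)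
    (hu : Measurable u)
    (hint : ∀ y, Integrable (fun x => Real.exp (-u x)) (gibbsKernel (conj W) y))
    (hV : TwiceDifferentiable V) (hA : TwiceDifferentiable A) :
    gradient (potentialStep V (conj W) u) = fun y =>
      gradient V y - gradient A y + Matrix.toEuclideanCLM (𝕜 := ℝ) χ
        (tiltMean (tiltBase B u) (Matrix.toEuclideanCLM (𝕜 := ℝ) χᵀ y)) :=
  gradient_eq (h.hasGradientAt_potentialStep_conj hχ hu hint hV hA)

lemma IsBilinearPotential.hasFDerivAt_gradient_potentialStep_conj
    (h : IsBilinearPotential W B A (Matrix.toEuclideanCLM (𝕜 := ℝ) χ)) (hχ : IsUnit χ.det)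
    (hu : Measurable u)
    (hint : ∀ y, Integrable (fun x => Real.exp (-u x)) (gibbsKernel (conj W) y))
    (hV : TwiceDifferentiable V) (hA : TwiceDifferentiable A) (y : E d) :
    HasFDerivAt (gradient (potentialStep V (conj W) u))
      (fderiv ℝ (gradient V) y - fderiv ℝ (gradient A) y + Matrix.toEuclideanCLM (𝕜 := ℝ)
        (χ * tiltCov (tiltBase B u) (Matrix.toEuclideanCLM (𝕜 := ℝ) χᵀ y) * χᵀ)) y := by
  have hρ := h.integrable_tiltBase hχ hu hint
  have hne := tiltBase_ne_zero h.measurable_left hu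
  rw [h.gradient_potentialStep_conj hχ hu hint hV hA]
  have h3 := hasFDerivAt_tiltMean hρ hne (Matrix.toEuclideanCLM (𝕜 := ℝ) χᵀ y)
  have h4 := h3.comp y (Matrix.toEuclideanCLM (𝕜 := ℝ) χᵀ).hasFDerivAt
  have h5 := (Matrix.toEuclideanCLM (𝕜 := ℝ) χ).hasFDerivAt.comp y h4
  refine (((hV.2 y).hasFDerivAt.sub (hA.2 y).hasFDerivAt).add h5).congr_fderiv ?_
  rw [mul_assoc, map_mul, map_mul]
  rfl

lemma IsBilinearPotential.twiceDifferentiable_potentialStep_conj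
    (h : IsBilinearPotential W B A (Matrix.toEuclideanCLM (𝕜 := ℝ) χ)) (hχ : IsUnit χ.det)
    (hu : Measurable u)
    (hint : ∀ y, Integrable (fun x => Real.exp (-u x)) (gibbsKernel (conj W) y))
    (hV : TwiceDifferentiable V) (hA : TwiceDifferentiable A) :
    TwiceDifferentiable (potentialStep V (conj W) u) :=
  ⟨fun y => (h.hasGradientAt_potentialStep_conj hχ hu hint hV hA y).differentiableAt,
    fun y => (h.hasFDerivAt_gradient_potentialStep_conj hχ hu hint hV hA y).differentiableAt⟩

/-- The Hessian of the potential `V + log K_{W^♭}(e^{-u})`, in terms of the conditional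
covariance. -/
lemma IsBilinearPotential.hessian_potentialStep_conj
    (h : IsBilinearPotential W B A (Matrix.toEuclideanCLM (𝕜 := ℝ) χ)) (hχ : IsUnit χ.det)
    (hu : Measurable u)
    (hint : ∀ y, Integrable (fun x => Real.exp (-u x)) (gibbsKernel (conj W) y))
    (hV : TwiceDifferentiable V) (hA : TwiceDifferentiable A) (y : E d) :
    hessian (potentialStep V (conj W) u) y = hessian V y - hessian A y +
      χ * tiltCov (tiltBase B u) (Matrix.toEuclideanCLM (𝕜 := ℝ) χᵀ y) * χᵀ := by
  ext i j
  simp only [hessian, Matrix.of_apply, Matrix.add_apply, Matrix.sub_apply]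
  rw [(h.hasFDerivAt_gradient_potentialStep_conj hχ hu hint hV hA y).fderiv,
    ← toEuclideanCLM_single (χ * _ * χᵀ)]
  rfl

/-- The first two conditional moments of a backward transition of `e^{-(u + W + v)}` are those of a
tilted measure. -/
lemma IsBackwardTransition.ae_eq_tilted
    (h : IsBilinearPotential W B A (Matrix.toEuclideanCLM (𝕜 := ℝ) χ)) (hχ : IsUnit χ.det)
    (hV : Measurable V) (hη : IsProbabilityMeasure (gibbsMeasure V)) (hu : Measurable u)
    (hint : ∀ y, Integrable (fun x => Real.exp (-u x)) (gibbsKernel (conj W) y))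
    {K : Kernel (E d) (E d)} [IsMarkovKernel K]
    (hK : IsBackwardTransition (gibbsMeasure V)
      (jointMeasure u (potentialStep V (conj W) u) W) K) :
    ∀ᵐ y ∂(gibbsMeasure V), MemLp id 2 (K y) ∧
      condMean K y = tiltMean (tiltBase B u) (Matrix.toEuclideanCLM (𝕜 := ℝ) χᵀ y) ∧
      condCov K y = tiltCov (tiltBase B u) (Matrix.toEuclideanCLM (𝕜 := ℝ) χᵀ y) := by
  have hvm := measurable_potentialStep (W := conj W) hV hu
  have hW' := h.conjugate.measurable
  have := isMarkovKernel_normalizedKernel hV hu hW' hint rfl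
  rw [IsBackwardTransition, jointMeasure_map_swap hu hvm h.measurable,
    jointMeasure_eq_compProd hV hvm hu hW'] at hK
  have hρ := h.integrable_tiltBase hχ hu hint
  -- Disintegrations agree only almost everywhere, whence the `η`-almost sure conclusion.
  filter_upwards [Kernel.ae_eq_of_compProd_eq hK] with y hy
  rw [h.normalizedKernel_conj_eq_tilted hV hu hint, toEuclideanCLM_adjoint] at hy
  have hm : condMean K y = tiltMean (tiltBase B u) (Matrix.toEuclideanCLM (𝕜 := ℝ) χᵀ y) := by
    rw [condMean, ← hy, tiltMean]
  refine ⟨hy ▸ memLp_id_tilted hρ _, hm, ?_⟩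
  rw [condCov, hm, ← hy, tiltCov]

end

/-! ### Frobenius and spectral norms -/

section Norms

lemma frobeniusNorm_nonneg (M : Matrix (Fin d) (Fin d) ℝ) : 0 ≤ frobeniusNorm M :=
  Real.sqrt_nonneg _

lemma spectralNorm₂_nonneg (M : Matrix (Fin d) (Fin d) ℝ) : 0 ≤ spectralNorm₂ M :=
  norm_nonneg _

lemma trace_transpose_mul_self (M : Matrix (Fin d) (Fin d) ℝ) :
    (Mᵀ * M).trace = ∑ j, ‖WithLp.toLp 2 (M.col j)‖ ^ 2 := by
  simp [Matrix.trace, Matrix.mul_apply, EuclideanSpace.norm_sq_eq, ← sq]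

lemma frobeniusNorm_transpose (M : Matrix (Fin d) (Fin d) ℝ) :
    frobeniusNorm Mᵀ = frobeniusNorm M := by
  rw [frobeniusNorm, frobeniusNorm, Matrix.transpose_transpose, Matrix.trace_mul_comm]

/-- The Frobenius norm of a product is bounded by the spectral norm times the Frobenius norm. -/
lemma frobeniusNorm_mul_le (M N : Matrix (Fin d) (Fin d) ℝ) :
    frobeniusNorm (M * N) ≤ spectralNorm₂ M * frobeniusNorm N := by
  refine Real.sqrt_le_iff.2 ⟨mul_nonneg (spectralNorm₂_nonneg M) (frobeniusNorm_nonneg N), ?_⟩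
  have hN : 0 ≤ (Nᵀ * N).trace := by
    rw [trace_transpose_mul_self]; positivity
  rw [mul_pow, frobeniusNorm, Real.sq_sqrt hN, trace_transpose_mul_self, trace_transpose_mul_self,
    Finset.mul_sum]
  -- Column by column: the columns of `M * N` are the images under `M` of those of `N`.
  refine Finset.sum_le_sum fun j _ => ?_
  rw [← mul_pow]
  have h1 := (Matrix.toEuclideanCLM (𝕜 := ℝ) M).le_opNorm (WithLp.toLp 2 (N.col j))
  have h2 : WithLp.toLp 2 ((M * N).col j) =
      Matrix.toEuclideanCLM (𝕜 := ℝ) M (WithLp.toLp 2 (N.col j)) := by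
    ext i
    simp [Matrix.mul_apply, Matrix.mulVec, dotProduct]
  rw [h2]
  exact pow_le_pow_left₀ (norm_nonneg _) h1 2

/-- Transposition preserves the Frobenius norm and brings the right factor `Mᵀ` to the left as `M`.
-/
lemma frobeniusNorm_mul_mul_transpose_le (M N : Matrix (Fin d) (Fin d) ℝ) :
    frobeniusNorm (M * N * Mᵀ) ≤ spectralNorm₂ M ^ 2 * frobeniusNorm N := by
  have h1 : frobeniusNorm (N * Mᵀ) ≤ spectralNorm₂ M * frobeniusNorm N := by
    rw [← frobeniusNorm_transpose, Matrix.transpose_mul, Matrix.transpose_transpose,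
      ← frobeniusNorm_transpose N]
    exact frobeniusNorm_mul_le M Nᵀ
  rw [mul_assoc, sq, mul_assoc]
  exact (frobeniusNorm_mul_le M _).trans
    (mul_le_mul_of_nonneg_left h1 (spectralNorm₂_nonneg M))

end Norms

/-! ### The Schrödinger bridge and the final estimates -/

lemma twiceDifferentiable_quadraticPotential (α : E d) (τ : Matrix (Fin d) (Fin d) ℝ) :
    TwiceDifferentiable (quadraticPotential α τ) := by
  have h : ContDiff ℝ 2 (quadraticPotential α τ) := by
    unfold quadraticPotential
    exact (ContDiff.inner ℝ (by fun_prop) (by fun_prop)).div_const 2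
  refine ⟨h.differentiable (by norm_num), ?_⟩
  have h1 : Differentiable ℝ (fderiv ℝ (quadraticPotential α τ)) :=
    (h.fderiv_right (m := 1) (by norm_num)).differentiable (by norm_num)
  have h2 : gradient (quadraticPotential α τ) =
      (InnerProductSpace.toDual ℝ (E d)).symm ∘ fderiv ℝ (quadraticPotential α τ) := rfl
  rw [h2]
  exact (InnerProductSpace.toDual ℝ (E d)).symm.toContinuousLinearEquiv.differentiable.comp h1

/-- The Schrödinger bridge is the Gibbs measure of the Schrödinger potentials. -/
lemma IsSchrodingerBridge.eq_jointMeasure {U V 𝕌 𝕍 A B : E d → ℝ} {W : E d → E d → ℝ}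
    {T : E d →L[ℝ] E d} {Q : Measure (E d × E d)} (h : IsBilinearPotential W B A T)
    (hU : Measurable U) (hV : Measurable V) (hμ : IsProbabilityMeasure (gibbsMeasure U))
    (hη : IsProbabilityMeasure (gibbsMeasure V)) [IsMarkovKernel (gibbsKernel W)]
    (hQ : IsSchrodingerBridge (gibbsMeasure U) (gibbsMeasure V) (referenceMeasure U W) Q)
    (hUV : IsSchrodingerPotentials U V W 𝕌 𝕍) : Q = jointMeasure 𝕌 𝕍 W := by
  have hp : IsProbabilityMeasure (jointMeasure U 0 W) := by
    rw [← gibbsMeasure_compProd_gibbsKernel hU h.measurable]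
    infer_instance
  rw [referenceMeasure, gibbsMeasure_compProd_gibbsKernel hU h.measurable] at hQ
  have h1 := jointMeasure_mem_firstMarginal hU hUV.measurable_snd h.measurable hμ
    hUV.integrable_snd hUV.eq_fst
  have h2 := jointMeasure_mem_secondMarginal hV hUV.measurable_fst h.measurable hη
    hUV.integrable_fst hUV.eq_snd
  -- Both potentials change here, from `(U, 0)` to `(𝕌, 𝕍)`, so the truncation argument for a sum of
  -- two possibly non-integrable terms is needed.
  exact IsEntropicProjection.eq_jointMeasure hU measurable_const hUV.measurable_fst
    hUV.measurable_snd h.measurable hQ hp hQ.1.1.1 ⟨h1, h2⟩ h1.1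
    (Or.inr (hQ.1.1.2.trans h1.2.symm)) (Or.inr (hQ.1.2.2.trans h2.2.symm))

end SinkhornBridge

theorem mainTheorem5 {d : ℕ}
    (U V : E d → ℝ) (hU : TwiceDifferentiable U) (hV : TwiceDifferentiable V)
    (hμ : IsProbabilityMeasure (gibbsMeasure U)) (hη : IsProbabilityMeasure (gibbsMeasure V))
    (α : E d) (β τ : Matrix (Fin d) (Fin d) ℝ) (hβ : IsUnit β.det) (hτ : τ.PosDef)
    (W : E d → E d → ℝ) (hW : W = gaussianPotential α β τ)
    -- the Schrödinger bridge, its potentials and its backward transition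
    (Q : Measure (E d × E d))
    (hQ : IsSchrodingerBridge (gibbsMeasure U) (gibbsMeasure V) (referenceMeasure U W) Q)
    (𝕌 𝕍 : E d → ℝ) (hUV : IsSchrodingerPotentials U V W 𝕌 𝕍)
    (L : Kernel (E d) (E d)) [IsMarkovKernel L]
    (hL : IsBackwardTransition (gibbsMeasure V) Q L)
    -- the Sinkhorn bridges and the backward transition of the bridge of index `2n+1`
    (P : ℕ → Measure (E d × E d))
    (hP : IsSinkhornSequence (gibbsMeasure U) (gibbsMeasure V) (referenceMeasure U W) P)
    (n : ℕ)
    (K : Kernel (E d) (E d)) [IsMarkovKernel K]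
    (hK : IsBackwardTransition (gibbsMeasure V) (P (2 * n + 1)) K) :
    -- all objects in the estimates are well defined
    ((∀ x, Integrable (fun y => Real.exp (-sinkhornV U V W (2 * n) y)) (gibbsKernel W x)) ∧
      (∀ y, Integrable (fun x => Real.exp (-sinkhornU U V W (2 * n + 1) x))
        (gibbsKernel (conj W) y)) ∧
      TwiceDifferentiable (sinkhornV U V W (2 * n + 1)) ∧ TwiceDifferentiable 𝕍 ∧
      (∀ᵐ y ∂(gibbsMeasure V), MemLp id 2 (K y) ∧ MemLp id 2 (L y))) ∧
    -- the gradient estimate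
    eLpNorm (fun y => gradient (sinkhornV U V W (2 * n + 1)) y - gradient 𝕍 y) 2
        (gibbsMeasure V) ^ 2
      ≤ ENNReal.ofReal (spectralNorm₂ (τ⁻¹ * β) ^ 2) *
        eLpNorm (fun y => condMean K y - condMean L y) 2 (gibbsMeasure V) ^ 2 ∧
    -- the Hessian estimate
    eLpNorm (fun y => frobeniusNorm (hessian (sinkhornV U V W (2 * n + 1)) y - hessian 𝕍 y)) 1
        (gibbsMeasure V)
      ≤ ENNReal.ofReal (spectralNorm₂ (τ⁻¹ * β) ^ 2) *
        eLpNorm (fun y => frobeniusNorm (condCov K y - condCov L y)) 1 (gibbsMeasure V) := by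
  subst hW
  have hUm : Measurable U := hU.1.continuous.measurable
  have hVm : Measurable V := hV.1.continuous.measurable
  have hMarkov := isMarkovKernel_gaussian hτ α β
  obtain ⟨B, hB⟩ := isBilinearPotential_gaussianPotential hτ α β
  have hχ : IsUnit (τ⁻¹ * β).det := by
    rw [Matrix.det_mul]
    exact (Matrix.isUnit_nonsing_inv_det τ hτ.det_pos.ne'.isUnit).mul hβ
  have hA := twiceDifferentiable_quadraticPotential α τ
  obtain ⟨hu, hv, hp, he⟩ := hP.eq_jointMeasure_even hB hUm hVm hμ hη n
  have hodd := hP.odd n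
  rw [he] at hodd hp
  have hPodd := hodd.eq_of_secondMarginal hB hVm hη hu hv hp
  have hint1 := hB.integrable_right hu hv hp
  have hint2 := hB.integrable_left hu hv hp
  have hQ' := IsSchrodingerBridge.eq_jointMeasure hB hUm hVm hμ hη hQ hUV
  rw [hPodd] at hK
  rw [hQ', hUV.eq_snd] at hL
  have hKt := hK.ae_eq_tilted hB hχ hVm hη hu hint2
  have hLt := hL.ae_eq_tilted hB hχ hVm hη hUV.measurable_fst hUV.integrable_fst
  -- Both potentials become the same map `potentialStep V (conj W)`, applied to `U_{2n}` and to `𝕌`.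
  rw [sinkhornV_odd, sinkhornU_odd, hUV.eq_snd]
  refine ⟨⟨hint1, hint2, hB.twiceDifferentiable_potentialStep_conj hχ hu hint2 hV hA,
    hB.twiceDifferentiable_potentialStep_conj hχ hUV.measurable_fst hUV.integrable_fst hV hA, ?_⟩,
    ?_, ?_⟩
  · filter_upwards [hKt, hLt] with y h1 h2 using ⟨h1.1, h2.1⟩
  · rw [ENNReal.ofReal_pow (spectralNorm₂_nonneg _), ← mul_pow]
    gcongr
    -- A pointwise bound almost everywhere suffices, even if the norms are infinite; `∇V - ∇A`
    -- cancels in it.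
    refine eLpNorm_le_mul_eLpNorm_of_ae_le_mul ?_ 2
    filter_upwards [hKt, hLt] with y h1 h2
    rw [hB.gradient_potentialStep_conj hχ hu hint2 hV hA,
      hB.gradient_potentialStep_conj hχ hUV.measurable_fst hUV.integrable_fst hV hA, h1.2.1, h2.2.1,
      add_sub_add_left_eq_sub, ← map_sub]
    exact ContinuousLinearMap.le_opNorm _ _
  · refine eLpNorm_le_mul_eLpNorm_of_ae_le_mul ?_ 1
    filter_upwards [hKt, hLt] with y h1 h2
    rw [hB.hessian_potentialStep_conj hχ hu hint2 hV hA,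
      hB.hessian_potentialStep_conj hχ hUV.measurable_fst hUV.integrable_fst hV hA, h1.2.2, h2.2.2,
      add_sub_add_left_eq_sub, ← Matrix.sub_mul, ← Matrix.mul_sub,
      Real.norm_of_nonneg (frobeniusNorm_nonneg _), Real.norm_of_nonneg (frobeniusNorm_nonneg _)]
    exact frobeniusNorm_mul_mul_transpose_le _ _
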